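/- Let $K$ be a field, $n\ge 1$, and let $I\subsetneq K[x_1,\dots,x_n]$ be a zero-dimensional ideal with $D=\dim_K K[x_1,\dots,x_n]/I$. Let $<_1$ be a term order and let $B=[\epsilon_1,\dots,\epsilon_D]$ be the canonical basis of the quotient, i.e. the monomials that are not the leading monomial of a nonzero element of $I$ with respect to $<_1$, in increasing order (so $\epsilon_1=1$). Let $T_1$ be the $D\times D$ matrix whose $j$-th column is the coordinate vector with respect to $B$ of the normal form of $x_1\epsilon_j$, let $N_1$ be the number of nonzero entries of $T_1$, let $v_i$ be the coordinate vector of the normal form of $x_i$, let $e=(1,0,\dots,0)^t$, and let $r\in K^D$ be any vector. LEX is the lexicographic order with $x_1<\dots<x_n$. The Wiedemann/Hankel method with input $(T_1,v_2,\dots,v_n,r)$ computes the vectors $r_i=(T_1^t)^i r$ for $0\le i<2D$, the sequence $s_i=\langle r,T_1^i e\rangle=\langle r_i,e\rangle$ for $0\le i<2D$, and its minimal polynomial $f_1$, i.e. the monic polynomial of least degree whose linear recurrence holds throughout $s_0,\dots,s_{2D-1}$. If $\deg f_1\ne D$ it reports failure. If $\deg f_1=D$ it computes, for $i=2,\dots,n$,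 the vector $b_i=(\langle r_j,v_i\rangle)_{0\le j<D}$ and the solution $c_i=H^{-1}b_i$ of the Hankel system with $H=(s_{j+k})_{0\le j,k<D}$, and returns $[f_1(x_1),x_2-f_2(x_1),\dots,x_n-f_n(x_1)]$ with $f_i=\sum_{k=0}^{D-1}c_{i,k}x_1^k$. **Theorem 3.2.** 1. If $\deg f_1=D$, then $I$ is in shape position (its reduced LEX Gröbner basis has the form $[g_1(x_1),x_2-g_2(x_1),\dots,x_n-g_n(x_1)]$), $H$ is invertible, and the list $[f_1,x_2-f_2,\dots,x_n-f_n]$ returned by the method is the reduced Gröbner basis of $I$ with respect to LEX. 2. There are an absolute constant $C$ and a single program, which do not depend on $K$, $n$, $I$, $<_1$ or $r$, such that the program carries out this method (computing all the quantities listed above, and reporting failure exactly if $\deg f_1\neq D$) and, whenever $\deg f_1=D$ and $T_1$ is nonsingular, uses at most $$C\cdot D\,\bigl(N_1+n\log D+E\bigr)$$ field operations, zero tests included. Here $E$ is the total number of nonzero entries of those $v_i$, $i\ge 2$, for which $x_i$ does not belong to $B$. The matrices $T_1$ and vectors $v_i$ are given by their nonzero entries; index arithmetic, copying, and the constants $0$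 and $1$ are not counted. In particular, if $x_2,\dots,x_n$ all belong to $B$, then $E=0$ and the method takes $O\bigl(D(N_1+\log D)+(n-1)D\log D\bigr)=O\bigl(D(N_1+n\log D)\bigr)$ field operations. -/

import Mathlib

open MvPolynomial Matrix

universe u v

namespace ShapeLex

/-! ### Term orders, standard monomials, normal forms and Gröbner bases -/

/-- The lexicographic term order on `K[x_1, …, x_n]` with `x_1 < ⋯ < x_n`; the variable `x_i` is
`X (i - 1)`.  Two exponents are compared at the largest index at which they differ. -/
noncomputable def lexOrder (n : ℕ) : MonomialOrder (Fin n) where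
  syn := Colex (Fin n →₀ ℕ)
  isOrderedAddMonoid_syn :=
    { add_le_add_left := fun a b h c => by
        rcases h.eq_or_lt with h | h
        · rw [h]
        · obtain ⟨i, hi, hlt⟩ := Finsupp.Colex.lt_iff.1 h
          refine le_of_lt (Finsupp.Colex.lt_iff.2 ⟨i, fun j hj => ?_, ?_⟩)
          · have := hi j hj
            change (ofColex a) j + (ofColex c) j = (ofColex b) j + (ofColex c) j
            exact congrArg (· + (ofColex c) j) this
          · change (ofColex a) i + (ofColex c) i < (ofColex b) i + (ofColex c) i
            exact Nat.add_lt_add_right hlt _ }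
  toSyn := { toEquiv := toColex, map_add' := fun _ _ => rfl }
  toSyn_monotone := Finsupp.toColex_monotone

variable {K : Type u} [Field K] {n : ℕ}

/-- The standard monomials of `I`: the exponents that are not the leading exponent of a nonzero
element of `I`. -/
def standardMonomials (m : MonomialOrder.{0, v} (Fin n)) (I : Ideal (MvPolynomial (Fin n) K)) :
    Set (Fin n →₀ ℕ) :=
  {s | ∀ p ∈ I, p ≠ 0 → m.degree p ≠ s}

/-- `q` is the normal form of `p` modulo `I`: it is congruent to `p` and only involves standard
monomials. -/
def IsNormalForm (m : MonomialOrder.{0, v} (Fin n)) (I : Ideal (MvPolynomial (Fin n) K))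
    (p q : MvPolynomial (Fin n) K) : Prop :=
  p - q ∈ I ∧ ∀ s ∈ q.support, s ∈ standardMonomials m I

/-- `G` is the reduced Gröbner basis of `I` with respect to `m`. -/
structure IsReducedGroebnerBasis (m : MonomialOrder.{0, v} (Fin n))
    (I : Ideal (MvPolynomial (Fin n) K)) (G : Set (MvPolynomial (Fin n) K)) : Prop where
  subset : G ⊆ I
  exists_degree_le : ∀ p ∈ I, p ≠ 0 → ∃ g ∈ G, m.degree g ≤ m.degree p
  monic : ∀ g ∈ G, m.Monic g
  reduced : ∀ g ∈ G, ∀ g' ∈ G, g' ≠ g → ∀ s ∈ g.support, ¬ m.degree g' ≤ s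

/-- The family `[f_1(x_1), x_2 - f_2(x_1), …, x_n - f_n(x_1)]`; here `f i` is `f_{i+1}` and the
value `f 0` is not used. -/
noncomputable def shapeFamily [NeZero n] (f₁ : Polynomial K) (f : Fin n → Polynomial K) (i : Fin n) :
    MvPolynomial (Fin n) K :=
  if i = 0 then Polynomial.aeval (X 0 : MvPolynomial (Fin n) K) f₁
  else X i - Polynomial.aeval (X 0 : MvPolynomial (Fin n) K) (f i)

/-- `I` is in shape position. -/
def IsShapePosition [NeZero n] (I : Ideal (MvPolynomial (Fin n) K)) : Prop :=
  ∃ (f₁ : Polynomial K) (f : Fin n → Polynomial K),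
    IsReducedGroebnerBasis (lexOrder n) I (Set.range (shapeFamily f₁ f))

/-! ### Linearly recurring sequences and Hankel matrices -/

/-- `p` is a characteristic polynomial of the finite sequence `s 0, …, s (N - 1)`. -/
def IsCharPoly (s : ℕ → K) (N : ℕ) (p : Polynomial K) : Prop :=
  p.Monic ∧ ∀ i, i + p.natDegree < N →
    ∑ j ∈ Finset.range (p.natDegree + 1), p.coeff j * s (i + j) = 0

/-- `p` is the minimal polynomial of the finite sequence `s 0, …, s (N - 1)`, as returned by the
Berlekamp–Massey algorithm: a characteristic polynomial of least degree. -/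
def IsMinPoly (s : ℕ → K) (N : ℕ) (p : Polynomial K) : Prop :=
  IsCharPoly s N p ∧ ∀ q, IsCharPoly s N q → p.natDegree ≤ q.natDegree

/-- The `d × d` Hankel matrix of `s`. -/
def hankel (d : ℕ) (s : ℕ → K) : Matrix (Fin d) (Fin d) K :=
  Matrix.of fun i j => s (i + j)

/-! ### The input of the method and the quantities that it computes -/

/-- The data of a change of ordering to LEX: a zero-dimensional ideal `I`, the given term order,
the canonical basis `ε` of the quotient listed in increasing order, the multiplication matrix `T`
of `x_1`, the coordinates `v i` of the normal form of each variable, and a vector `r`. -/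
structure Input (K : Type u) [Field K] (n : ℕ) [NeZero n] where
  I : Ideal (MvPolynomial (Fin n) K)
  ne_top : I ≠ ⊤
  finite : Module.Finite K (MvPolynomial (Fin n) K ⧸ I)
  ord : MonomialOrder.{0, v} (Fin n)
  D : ℕ
  ε : Fin D → Fin n →₀ ℕ
  strictMono_ε : StrictMono fun k => ord.toSyn (ε k)
  range_ε : Set.range ε = standardMonomials ord I
  T : Matrix (Fin D) (Fin D) K
  T_spec : ∀ j, IsNormalForm ord I (X 0 * monomial (ε j) 1) (∑ k, monomial (ε k) (T k j))
  v : Fin n → Fin D → K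
  v_spec : ∀ i, IsNormalForm ord I (X i) (∑ k, monomial (ε k) (v i k))
  r : Fin D → K

namespace Input

variable [NeZero n] (A : Input.{u, v} K n)

/-- The coordinate vector `e = (1, 0, …, 0)` of `1`. -/
def e : Fin A.D → K := fun k => if (k : ℕ) = 0 then 1 else 0

/-- The sequence `⟨r, T^i e⟩`. -/
def seq (i : ℕ) : K := A.r ⬝ᵥ ((A.T ^ i) *ᵥ A.e)

/-- The vectors `r_i = (Tᵗ)^i r`. -/
def krylov (i : ℕ) : Fin A.D → K := (A.Tᵀ ^ i) *ᵥ A.r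

/-- The right-hand side `b_i = (⟨r_j, v_i⟩)_j` of the `i`-th Hankel system. -/
def rhs (i : Fin n) : Fin A.D → K := fun j => A.krylov j ⬝ᵥ A.v i

/-- The solution `c_i = H⁻¹ b_i` of the `i`-th Hankel system. -/
noncomputable def sol (i : Fin n) : Fin A.D → K := (hankel A.D A.seq)⁻¹ *ᵥ A.rhs i

/-- The polynomial `f_i = ∑ c_{i,k} x^k`. -/
noncomputable def solPoly (i : Fin n) : Polynomial K :=
  ∑ k : Fin A.D, Polynomial.C (A.sol i k) * Polynomial.X ^ (k : ℕ)

/-- The number of nonzero entries of the multiplication matrix of `x_1`. -/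
noncomputable def nnzT : ℕ := Set.ncard {p : Fin A.D × Fin A.D | A.T p.1 p.2 ≠ 0}

/-- The total number of terms of the normal forms of those variables `x_i`, `i ≥ 2`, that are not
standard monomials.  It is `0` if all of `x_2, …, x_n` belong to the canonical basis. -/
noncomputable def nnzElim : ℕ :=
  Set.ncard {p : Fin n × Fin A.D |
    p.1 ≠ 0 ∧ Finsupp.single p.1 1 ∉ standardMonomials A.ord A.I ∧ A.v p.1 p.2 ≠ 0}

/-- `l` lists the positions of the nonzero entries of `T`, each once, in any order. -/
def IsSparseT (l : List (Fin A.D × Fin A.D)) : Prop :=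
  l.Nodup ∧ ∀ p, p ∈ l ↔ A.T p.1 p.2 ≠ 0

/-- `l` lists the positions of the nonzero entries of `v_2, …, v_n`, each once, in any order. -/
def IsSparseV (l : List (Fin n × Fin A.D)) : Prop :=
  l.Nodup ∧ ∀ p, p ∈ l ↔ p.1 ≠ 0 ∧ A.v p.1 p.2 ≠ 0

end Input

/-! ### The machine model

Programs act on countably many arrays of natural numbers, used for sizes, indices and counters, and
countably many arrays of field elements.  Field elements can be combined by the field operations
and compared with zero, and there is no other way in which they influence the control flow.  The
cost is the number of field operations, zero tests included; index arithmetic, copying and the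
constants `0` and `1` are free.  A program does not depend on the field. -/

/-- Index expressions; `get a i` reads cell `i` of the natural-number array `a`, and `sub` is
truncated subtraction. -/
inductive NExpr : Type
  | const (k : ℕ)
  | get (a : ℕ) (i : NExpr)
  | add (x y : NExpr)
  | sub (x y : NExpr)
  | mul (x y : NExpr)

/-- The binary field operations, with the convention `x / 0 = 0`. -/
inductive FOp : Type
  | add
  | sub
  | mul
  | div

/-- Programs. -/
inductive Prog : Type
  /-- Do nothing. -/
  | skip
  /-- Sequential composition. -/
  | seq (c d : Prog)
  /-- Store `x` in cell `i` of the natural-number array `a`. -/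
  | setN (a : ℕ) (i x : NExpr)
  /-- Store the constant `1` (if `one`) or `0` in cell `i` of the field array `a`. -/
  | setF (a : ℕ) (i : NExpr) (one : Bool)
  /-- Copy cell `j` of the field array `b` to cell `i` of the field array `a`. -/
  | copyF (a : ℕ) (i : NExpr) (b : ℕ) (j : NExpr)
  /-- Field operation on cell `j` of array `b` and cell `k` of array `c`, with the result in
  cell `i` of array `a`. -/
  | opF (o : FOp) (a : ℕ) (i : NExpr) (b : ℕ) (j : NExpr) (c : ℕ) (k : NExpr)
  /-- Run `c` if the natural number `x` is zero, and `d` otherwise. -/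
  | ifN (x : NExpr) (c d : Prog)
  /-- Run `c` if cell `j` of the field array `b` is zero, and `d` otherwise. -/
  | ifF (b : ℕ) (j : NExpr) (c d : Prog)
  /-- For `t = 0, …, x - 1` (with `x` evaluated once, on entry) store `t` in cell `0` of the
  natural-number array `a` and run `c`. -/
  | loop (a : ℕ) (x : NExpr) (c : Prog)

/-- A memory state, with the number of field operations spent so far. -/
structure State (K : Type u) : Type u where
  nat : ℕ → ℕ → ℕ
  fld : ℕ → ℕ → K
  ops : ℕ

/-- Value of an index expression. -/
def NExpr.eval (μ : ℕ → ℕ → ℕ) : NExpr → ℕ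
  | .const k => k
  | .get a i => μ a (i.eval μ)
  | .add x y => x.eval μ + y.eval μ
  | .sub x y => x.eval μ - y.eval μ
  | .mul x y => x.eval μ * y.eval μ

/-- Value of a field operation. -/
def FOp.eval (o : FOp) (x y : K) : K :=
  match o with
  | .add => x + y
  | .sub => x - y
  | .mul => x * y
  | .div => x / y

/-- Overwrite cell `i` of array `a`. -/
def update {α : Type u} (μ : ℕ → ℕ → α) (a i : ℕ) (x : α) : ℕ → ℕ → α :=
  fun b j => if b = a ∧ j = i then x else μ b j

/-- Repeat: `iter g x s` applies `g 0`, then `g 1`, …, then `g (x - 1)` to `s`. -/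
def iter {α : Type u} (g : ℕ → α → α) : ℕ → α → α
  | 0, s => s
  | x + 1, s => g x (iter g x s)

/-- Execution of a program. -/
def Prog.run [DecidableEq K] : Prog → State K → State K
  | .skip, s => s
  | .seq c d, s => d.run (c.run s)
  | .setN a i x, s => { s with nat := update s.nat a (i.eval s.nat) (x.eval s.nat) }
  | .setF a i one, s => { s with fld := update s.fld a (i.eval s.nat) (if one then 1 else 0) }
  | .copyF a i b j, s =>
      { s with fld := update s.fld a (i.eval s.nat) (s.fld b (j.eval s.nat)) }
  | .opF o a i b j c k, s =>
      { s with
        fld := update s.fld a (i.eval s.nat)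
          (o.eval (s.fld b (j.eval s.nat)) (s.fld c (k.eval s.nat)))
        ops := s.ops + 1 }
  | .ifN x c d, s => if x.eval s.nat = 0 then c.run s else d.run s
  | .ifF b j c d, s =>
      if s.fld b (j.eval s.nat) = 0 then c.run { s with ops := s.ops + 1 }
      else d.run { s with ops := s.ops + 1 }
  | .loop a x c, s =>
      iter (fun t s' => c.run { s' with nat := update s'.nat a 0 t }) (x.eval s.nat) s

/-! ### Input and output conventions -/


namespace Input

variable [NeZero n] (A : Input.{u, v} K n)

/-- The initial state.  Natural-number array `0` holds `n`, `D` and the lengths of the two lists of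
nonzero entries; arrays `1`, `2` hold the rows and columns of the nonzero entries of `T`; arrays
`3`, `4` hold, for each nonzero entry `(v_i)_k`, the indices `i` and `k`.  The field arrays `0`, `1`,
`2` hold the nonzero entries of `T`, the vector `r` and the nonzero entries of the `v_i`.  All other
cells are `0`. -/
def initState (l : List (Fin A.D × Fin A.D)) (w : List (Fin n × Fin A.D)) : State K where
  nat a := match a with
    | 0 => fun i => [n, A.D, l.length, w.length].getD i 0
    | 1 => fun i => (l.map fun p => (p.1 : ℕ)).getD i 0
    | 2 => fun i => (l.map fun p => (p.2 : ℕ)).getD i 0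
    | 3 => fun i => (w.map fun p => (p.1 : ℕ)).getD i 0
    | 4 => fun i => (w.map fun p => (p.2 : ℕ)).getD i 0
    | _ => fun _ => 0
  fld a := match a with
    | 0 => fun i => (l.map fun p => A.T p.1 p.2).getD i 0
    | 1 => fun i => (List.ofFn A.r).getD i 0
    | 2 => fun i => (w.map fun p => A.v p.1 p.2).getD i 0
    | _ => fun _ => 0
  ops := 0

/-- The final state reports success and contains everything that the method computes when the
minimal polynomial `f` of the sequence has degree `D`: the vectors `r_0, …, r_{2D-1}` (field array
`3`), the sequence (array `4`), the coefficients of `f` (array `5`), and for each `i ≥ 2` the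
right-hand side `b_i` (array `6`) and the solution `c_i = H⁻¹ b_i` (array `7`), that is, the
coefficients of `f_i`. -/
structure IsSuccess (f : Polynomial K) (s : State K) : Prop where
  flag : s.nat 5 0 = 1
  krylov : ∀ i < 2 * A.D, ∀ j : Fin A.D, s.fld 3 (i * A.D + j) = A.krylov i j
  seq : ∀ i < 2 * A.D, s.fld 4 i = A.seq i
  minPoly : ∀ k ≤ A.D, s.fld 5 k = f.coeff k
  rhs : ∀ i : Fin n, i ≠ 0 → ∀ j : Fin A.D, s.fld 6 (i * A.D + j) = A.rhs i j
  sol : ∀ i : Fin n, i ≠ 0 → ∀ k : Fin A.D, s.fld 7 (i * A.D + k) = A.sol i k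

end Input

/-- The final state reports that the method fails. -/
def State.IsFail (s : State K) : Prop := s.nat 5 0 = 0

end ShapeLex

/-! Let `M` be the Krylov matrix with columns `e, T e, …, T^(D-1) e` and `R` the matrix with rows
`r_0, …, r_(D-1)`. Then `H = R M` and `b_i = R v_i`, so as soon as `H` is invertible `c_i = M⁻¹
v_i`: the Hankel solution is the coordinate vector of `x_i` in the powers of `x_1`, whatever `r` is.

Consider the functional `X^i ↦ s_i` on `K[X]` (`moment`). By Cayley–Hamilton, a polynomial of degree
`< D` annihilated against `1, …, X^(D-1)` is annihilated against everything, and would be a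
recurrence of degree `< D` (`eq_zero_of_moment_eq_zero`). So if `deg f_1 = D`, then `H` is
invertible and `f_1` is the characteristic polynomial of `T`. Hence the powers `1, …, x_1^(D-1)`
form a basis of the quotient, `f_1(x_1)` and all `x_i - f_i(x_1)` lie in `I`, and
`isReducedGroebnerBasis_shapeFamily` applies.

The program solves no Hankel system. Quadratic Berlekamp–Massey yields, besides `f_1`, an auxiliary
polynomial `h` and a scalar `b ≠ 0` such that `b⁻¹ h(Tᵗ) r` is dual to `T^(D-1) e` in the Krylov
basis (`dual_dotProduct`). A transposed Horner scheme extends this vector to all rows of `M⁻¹`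
(`horner_mul_krylovMatrix`), at one sparse product with `Tᵗ` and `O(D)` further operations per row.
Each `c_{i,k}` is then an inner product with the sparse vector `v_i`.

With `W` nonzero entries in the `v_i`, the cost is `O(D N_1 + D² + D W)`. A nonsingular `T` has `D ≤
N_1`, and the variables in `B` contribute at most `D` entries in total, so `W ≤ E + D`. This gives
`O(D (N_1 + E))`; the term `n log D` is only slack. -/

namespace ShapeLex

/-! ### Linear recurrences and the Berlekamp–Massey invariant -/

section Recurrence

open scoped Polynomial

variable {K : Type u} [Field K]

/-- The linear functional on `K[X]` with moments `s`. -/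
noncomputable def moment (s : ℕ → K) : K[X] →ₗ[K] K :=
  Polynomial.lsum fun i => LinearMap.toSpanSingleton K K (s i)

theorem moment_eq_sum (s : ℕ → K) {p : K[X]} {m : ℕ} (hm : p.natDegree < m) (j : ℕ) :
    moment s (Polynomial.X ^ j * p) = ∑ k ∈ Finset.range m, p.coeff k * s (j + k) := by
  conv_lhs => rw [p.as_sum_range' m hm, Finset.mul_sum, map_sum]
  refine Finset.sum_congr rfl fun k _ => ?_
  rw [Polynomial.X_pow_mul_monomial, moment, Polynomial.lsum_apply,
    Polynomial.sum_monomial_index _ _ (by simp)]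
  simp [add_comm]

theorem moment_mul_eq_zero (s : ℕ → K) {p q : K[X]} {N : ℕ}
    (h : ∀ j < N, moment s (Polynomial.X ^ j * p) = 0) (hq : q.natDegree < N) :
    moment s (q * p) = 0 := by
  rw [q.as_sum_range' N hq, Finset.sum_mul, map_sum]
  refine Finset.sum_eq_zero fun k hk => ?_
  rw [← Polynomial.C_mul_X_pow_eq_monomial, mul_assoc, ← Polynomial.smul_eq_C_mul, map_smul,
    h k (Finset.mem_range.1 hk), smul_zero]

theorem isCharPoly_iff_moment (s : ℕ → K) (N : ℕ) (p : K[X]) :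
    IsCharPoly s N p ↔
      p.Monic ∧ ∀ i, i + p.natDegree < N → moment s (Polynomial.X ^ i * p) = 0 := by
  simp only [IsCharPoly, moment_eq_sum s (Nat.lt_succ_self p.natDegree)]

/-- The state of the Berlekamp–Massey algorithm after `N` terms of `s`: `g` is a characteristic
polynomial of degree `L`, and `h` certifies that there is none of smaller degree. -/
structure IsBerlekampMassey (s : ℕ → K) (N L : ℕ) (g h : K[X]) (b : K) : Prop where
  monic : g.Monic
  natDegree : g.natDegree = L
  le : L ≤ N
  moment_eq_zero : ∀ j, j + L < N → moment s (Polynomial.X ^ j * g) = 0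
  ne_zero : b ≠ 0
  moment_eq : ∀ j < L, moment s (Polynomial.X ^ j * h) = if j + 1 = L then b else 0
  natDegree_add_le : h.natDegree + L ≤ N

namespace IsBerlekampMassey

variable {s : ℕ → K} {N L : ℕ} {g h : K[X]} {b : K}

theorem init (s : ℕ → K) : IsBerlekampMassey s 0 0 1 0 1 where
  monic := Polynomial.monic_one
  natDegree := Polynomial.natDegree_one
  le := le_rfl
  moment_eq_zero := by simp
  ne_zero := one_ne_zero
  moment_eq := by simp
  natDegree_add_le := by simp

theorem isCharPoly (H : IsBerlekampMassey s N L g h b) : IsCharPoly s N g :=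
  (isCharPoly_iff_moment s N g).2 ⟨H.monic, fun i hi => H.moment_eq_zero i (H.natDegree ▸ hi)⟩

theorem moment_monic_mul (H : IsBerlekampMassey s N L g h b) {q : K[X]} (hq : q.Monic)
    (hL : q.natDegree + 1 = L) : moment s (q * h) = b := by
  rw [hq.as_sum, add_mul, map_add, H.moment_eq _ (by omega), if_pos hL, Finset.sum_mul, map_sum,
    Finset.sum_eq_zero, add_zero]
  intro k hk
  have := Finset.mem_range.1 hk
  rw [mul_assoc, ← Polynomial.smul_eq_C_mul, map_smul, H.moment_eq k (by omega),
    if_neg (by omega), smul_zero]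

/-- Evaluate the functional on `X^(L-1-deg q) * q * h` in two ways. The factor without `h` is monic
of degree `L - 1`, so the value is `b ≠ 0`. The factor without `q` has degree below `N - deg q`,
where the recurrence of `q` makes the value `0`. -/
theorem le_natDegree (H : IsBerlekampMassey s N L g h b) {q : K[X]} (hq : IsCharPoly s N q) :
    L ≤ q.natDegree := by
  rw [isCharPoly_iff_moment] at hq
  by_contra! hlt
  have h1 := H.moment_monic_mul (q := Polynomial.X ^ (L - 1 - q.natDegree) * q)
    ((Polynomial.monic_X_pow _).mul hq.1)
    (by rw [(Polynomial.monic_X_pow _).natDegree_mul hq.1, Polynomial.natDegree_X_pow]; omega)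
  refine H.ne_zero (h1.symm.trans ?_)
  rw [mul_right_comm]
  refine moment_mul_eq_zero s (N := N - q.natDegree) (fun j hj => hq.2 j (by omega)) ?_
  have h2 := H.natDegree_add_le
  have h3 := Polynomial.natDegree_mul_le
    (p := (Polynomial.X : K[X]) ^ (L - 1 - q.natDegree)) (q := h)
  rw [Polynomial.natDegree_X_pow] at h3
  omega

theorem step_of_eq_zero (H : IsBerlekampMassey s N L g h b)
    (hd : moment s (Polynomial.X ^ (N - L) * g) = 0) : IsBerlekampMassey s (N + 1) L g h b where
  monic := H.monic
  natDegree := H.natDegree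
  le := H.le.trans (Nat.le_succ N)
  moment_eq_zero j hj := by
    rcases Nat.lt_succ_iff_lt_or_eq.1 hj with hj | hj
    · exact H.moment_eq_zero j hj
    · rwa [show j = N - L by omega]
  ne_zero := H.ne_zero
  moment_eq := H.moment_eq
  natDegree_add_le := H.natDegree_add_le.trans (Nat.le_succ N)

/-- The update of the characteristic polynomial when its discrepancy is `d`. -/
noncomputable def next (N L : ℕ) (g h : K[X]) (b d : K) : K[X] :=
  Polynomial.X ^ (N + 1 - 2 * L) * g +
    Polynomial.C ((0 - d) / b) * (Polynomial.X ^ (2 * L - (N + 1)) * h)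

theorem moment_next (N L : ℕ) (g h : K[X]) (b d : K) (j : ℕ) :
    moment s (Polynomial.X ^ j * next N L g h b d) =
      moment s (Polynomial.X ^ (j + (N + 1 - 2 * L)) * g) +
      (0 - d) / b * moment s (Polynomial.X ^ (j + (2 * L - (N + 1))) * h) := by
  rw [next, mul_add, map_add, ← Polynomial.smul_eq_C_mul, mul_smul_comm, map_smul, ← mul_assoc,
    ← mul_assoc,
    ← pow_add, ← pow_add, smul_eq_mul]

/-- The two truncated shifts are never both positive, so the single formula for `next` serves with
and without a change of length. The bound `deg h + L ≤ N` keeps the correction below the degree of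
the shifted `g`. -/
theorem next_aux (H : IsBerlekampMassey s N L g h b) (d : K) :
    (next N L g h b d).Monic ∧
      (next N L g h b d).natDegree = L + (N + 1 - 2 * L) := by
  have h1 : (Polynomial.X ^ (N + 1 - 2 * L) * g).Monic := (Polynomial.monic_X_pow _).mul H.monic
  have h2 : (Polynomial.X ^ (N + 1 - 2 * L) * g).natDegree = L + (N + 1 - 2 * L) := by
    rw [(Polynomial.monic_X_pow _).natDegree_mul H.monic, Polynomial.natDegree_X_pow,
      H.natDegree, add_comm]
  have h3 : (Polynomial.C ((0 - d) / b) * (Polynomial.X ^ (2 * L - (N + 1)) * h)).natDegree <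
      (Polynomial.X ^ (N + 1 - 2 * L) * g).natDegree := by
    have h4 := Polynomial.natDegree_C_mul_le ((0 - d) / b) (Polynomial.X ^ (2 * L - (N + 1)) * h)
    have h5 := Polynomial.natDegree_mul_le (p := (Polynomial.X : K[X]) ^ (2 * L - (N + 1))) (q := h)
    rw [Polynomial.natDegree_X_pow] at h5
    have h6 := H.natDegree_add_le
    have h7 := H.le
    omega
  refine ⟨h1.add_of_left (Polynomial.degree_lt_degree h3), ?_⟩
  rw [next, Polynomial.natDegree_add_eq_left_of_natDegree_lt h3, h2]

/-- The shifted `h` has a nonzero moment only at the one new index `j = N - L`, where `-d/b * b`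
cancels the discrepancy `d`; the earlier conditions are undisturbed. -/
theorem step_of_le (H : IsBerlekampMassey s N L g h b) (hN : N + 1 ≤ 2 * L) :
    IsBerlekampMassey s (N + 1) L (next N L g h b (moment s (Polynomial.X ^ (N - L) * g))) h b where
  monic := (H.next_aux _).1
  natDegree := (H.next_aux _).2.trans (by omega)
  le := H.le.trans (Nat.le_succ N)
  moment_eq_zero j hj := by
    have hle := H.le
    rw [moment_next, H.moment_eq _ (by omega)]
    rcases Nat.lt_succ_iff_lt_or_eq.1 hj with hj | hj
    · rw [H.moment_eq_zero _ (by omega), if_neg (by omega)]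
      simp
    · rw [if_pos (by omega), show j + (N + 1 - 2 * L) = N - L by omega]
      field_simp [H.ne_zero]
      ring
  ne_zero := H.ne_zero
  moment_eq := H.moment_eq
  natDegree_add_le := H.natDegree_add_le.trans (Nat.le_succ N)

/-- The old `g` becomes the certificate for the new length: its moments vanish up to index `N - L`,
the last index below `N + 1 - L`, where the value is the discrepancy. This is why `d ≠ 0` is needed.
-/
theorem step_of_lt (H : IsBerlekampMassey s N L g h b) (hN : 2 * L < N + 1)
    (hd : moment s (Polynomial.X ^ (N - L) * g) ≠ 0) :
    IsBerlekampMassey s (N + 1) (N + 1 - L)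
      (next N L g h b (moment s (Polynomial.X ^ (N - L) * g))) g
      (moment s (Polynomial.X ^ (N - L) * g)) where
  monic := (H.next_aux _).1
  natDegree := (H.next_aux _).2.trans (by omega)
  le := Nat.sub_le _ _
  moment_eq_zero j hj := by
    have hle := H.le
    rw [moment_next, H.moment_eq _ (by omega)]
    by_cases hj' : j + (N + 1 - 2 * L) = N - L
    · rw [if_pos (by omega), hj']
      field_simp [H.ne_zero]
      ring
    · rw [H.moment_eq_zero _ (by omega), if_neg (by omega)]
      simp
  ne_zero := hd
  moment_eq j hj := by
    have hle := H.le
    split_ifs with h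
    · rw [show j = N - L by omega]
    · exact H.moment_eq_zero j (by omega)
  natDegree_add_le := by
    have := H.le
    rw [H.natDegree]; omega

end IsBerlekampMassey

end Recurrence

/-! ### The Krylov basis and its dual basis -/

section Krylov

open scoped Polynomial

variable {K : Type u} [Field K] {D : ℕ} (T : Matrix (Fin D) (Fin D) K) (e r : Fin D → K)

theorem moment_krylov (p : K[X]) :
    moment (fun i => r ⬝ᵥ (T ^ i *ᵥ e)) p = r ⬝ᵥ (Polynomial.aeval T p *ᵥ e) := by
  induction p using Polynomial.induction_on' with
  | add p q hp hq => rw [map_add, hp, hq, map_add, add_mulVec, dotProduct_add]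
  | monomial k a =>
    rw [Polynomial.aeval_monomial, moment, Polynomial.lsum_apply,
      Polynomial.sum_monomial_index _ _ (by simp), ← Algebra.smul_def,
      smul_mulVec, dotProduct_smul]
    simp

theorem transpose_pow_dotProduct (i : ℕ) (w : Fin D → K) :
    (Tᵀ ^ i *ᵥ r) ⬝ᵥ w = r ⬝ᵥ (T ^ i *ᵥ w) := by
  rw [← transpose_pow, mulVec_transpose, dotProduct_mulVec]

/-- The matrix with columns `e, T e, …, T ^ (D - 1) e`. -/
def krylovMatrix : Matrix (Fin D) (Fin D) K := Matrix.of fun k j => (T ^ (j : ℕ) *ᵥ e) k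

theorem krylovMatrix_mulVec (c : Fin D → K) :
    krylovMatrix T e *ᵥ c =
      Polynomial.aeval T (∑ k : Fin D, Polynomial.C (c k) * Polynomial.X ^ (k : ℕ)) *ᵥ e := by
  rw [map_sum, sum_mulVec]
  ext i
  simp only [krylovMatrix, mulVec, dotProduct, of_apply, Finset.sum_apply]
  refine Finset.sum_congr rfl fun k _ => ?_
  rw [map_mul, Polynomial.aeval_C, Polynomial.aeval_X_pow, ← Algebra.smul_def]
  simp [Finset.mul_sum, mul_comm, mul_left_comm]

/-- The transposed Horner scheme `Z 0 = 0`, `Z (t + 1) = Tᵗ Z t + a_{D - t} r`. -/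
def horner (T : Matrix (Fin D) (Fin D) K) (a : ℕ → K) (r : Fin D → K) : ℕ → Fin D → K
  | 0 => 0
  | t + 1 => Tᵀ *ᵥ horner T a r t + a (D - t) • r

theorem sum_coeff_mul_dotProduct_pow {f : K[X]} (hf : Polynomial.aeval T f = 0)
    (hD : f.natDegree = D)
    (z : Fin D → K) :
    ∑ i ∈ Finset.range (D + 1), f.coeff i * (z ⬝ᵥ (T ^ i *ᵥ e)) = 0 := by
  have h := moment_eq_sum (fun i => z ⬝ᵥ (T ^ i *ᵥ e)) (p := f) (m := D + 1) (by omega) 0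
  rw [pow_zero, one_mul, moment_krylov, hf, zero_mulVec, dotProduct_zero] at h
  simpa using h.symm

/-- If `r` is dual to `T ^ (D - 1) e`, the Horner scheme yields the basis dual to the Krylov
basis. -/
theorem horner_dotProduct {f : K[X]} (hf : Polynomial.aeval T f = 0) (hm : f.Monic)
    (hD : f.natDegree = D)
    (hr : ∀ i < D, r ⬝ᵥ (T ^ i *ᵥ e) = if i + 1 = D then 1 else 0) {t : ℕ} (ht : t < D) :
    ∀ i < D, horner T f.coeff r (t + 1) ⬝ᵥ (T ^ i *ᵥ e) = if i + t + 1 = D then 1 else 0 := by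
  induction t with
  | zero =>
    intro i hi
    have : f.coeff D = 1 := by rw [← hD]; exact hm
    simpa [horner, this] using hr i hi
  | succ t ih =>
    intro i hi
    have ih := ih (by omega)
    have key : (Tᵀ *ᵥ horner T f.coeff r (t + 1)) ⬝ᵥ (T ^ i *ᵥ e) =
        horner T f.coeff r (t + 1) ⬝ᵥ (T ^ (i + 1) *ᵥ e) := by
      have := transpose_pow_dotProduct T (horner T f.coeff r (t + 1)) 1 (T ^ i *ᵥ e)
      rwa [pow_one, pow_one, mulVec_mulVec, ← pow_succ'] at this
    rw [horner, add_dotProduct, smul_dotProduct, key, hr i hi, smul_eq_mul]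
    -- For `i = D - 1` the vector `T^D e` leaves the Krylov basis. Expanding it by `f(T) e = 0`
    -- leaves minus the coefficient of `f` at `D - (t + 1)`, which the term added by the Horner step
    -- cancels. For smaller `i` that term vanishes and the duality index just shifts.
    by_cases hi' : i + 1 = D
    · have h := sum_coeff_mul_dotProduct_pow T e hf hD (horner T f.coeff r (t + 1))
      have hc : f.coeff D = 1 := by rw [← hD]; exact hm
      rw [Finset.sum_range_succ, hc, one_mul, Finset.sum_eq_single (D - (t + 1)),
        ih _ (by omega), if_pos (by omega), mul_one] at h
      · rw [hi', if_pos rfl, if_neg (by omega), mul_one, add_comm, h]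
      · intro j hj hne
        have := Finset.mem_range.1 hj
        rw [ih j this, if_neg (by omega), mul_zero]
      · intro hj
        exact absurd (Finset.mem_range.2 (by omega)) hj
    · rw [ih _ (by omega), if_neg hi', mul_zero, add_zero]
      congr 1
      exact propext (by omega)

/-- The Horner vectors are the dual basis in reverse order, so vector `D - k` is row `k` of the
inverse. -/
theorem horner_mul_krylovMatrix {f : K[X]} (hf : Polynomial.aeval T f = 0) (hm : f.Monic)
    (hD : f.natDegree = D)
    (hr : ∀ i < D, r ⬝ᵥ (T ^ i *ᵥ e) = if i + 1 = D then 1 else 0) :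
    (Matrix.of fun (k j : Fin D) => horner T f.coeff r (D - k) j) * krylovMatrix T e = 1 := by
  ext k i
  have hk := k.isLt
  have h := horner_dotProduct T e r hf hm hD hr (t := D - k - 1) (by omega) i i.isLt
  rw [show D - (k : ℕ) - 1 + 1 = D - k by omega] at h
  rw [mul_apply, one_apply]
  refine h.trans ?_
  congr 1
  rw [Fin.ext_iff]
  exact propext (by omega)

end Krylov
-- Minimal polynomials of full degree
section MinPoly

open scoped Polynomial

variable {K : Type u} [Field K] {D : ℕ} (T : Matrix (Fin D) (Fin D) K) (e r : Fin D → K)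

theorem natDegree_charpoly_fin : T.charpoly.natDegree = D := by
  rw [T.charpoly_natDegree_eq_dim, Fintype.card_fin]

theorem moment_charpoly_mul (p : K[X]) :
    moment (fun i => r ⬝ᵥ (T ^ i *ᵥ e)) (T.charpoly * p) = 0 := by
  rw [moment_krylov, map_mul, aeval_self_charpoly, zero_mul, zero_mulVec, dotProduct_zero]

variable {T e r}

/-- The characteristic polynomial of `T` generates recurrences of the sequence, so `p` may be
replaced by its remainder, of degree `< D`. -/
theorem moment_mul_eq_zero_of_lt {q : K[X]}
    (h : ∀ j < D, moment (fun i => r ⬝ᵥ (T ^ i *ᵥ e)) (Polynomial.X ^ j * q) = 0) (p : K[X]) :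
    moment (fun i => r ⬝ᵥ (T ^ i *ᵥ e)) (p * q) = 0 := by
  rcases Nat.eq_zero_or_pos D with rfl | hD
  · rw [moment_krylov]; simp [dotProduct]
  · rw [← Polynomial.modByMonic_add_div p T.charpoly, add_mul, map_add, mul_assoc,
      moment_charpoly_mul, add_zero]
    refine moment_mul_eq_zero _ h ?_
    have := Polynomial.natDegree_modByMonic_lt p T.charpoly_monic (by
      intro h1
      have := natDegree_charpoly_fin T
      rw [h1, Polynomial.natDegree_one] at this
      omega)
    rwa [natDegree_charpoly_fin] at this

/-- Otherwise `q`, made monic, would be a characteristic polynomial of degree `< D`, against the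
minimality of `f`. -/
theorem eq_zero_of_moment_eq_zero {N : ℕ} {f q : K[X]}
    (hf : IsMinPoly (fun i => r ⬝ᵥ (T ^ i *ᵥ e)) N f) (hD : f.natDegree = D)
    (hq : q.degree < D)
    (h : ∀ j < D, moment (fun i => r ⬝ᵥ (T ^ i *ᵥ e)) (Polynomial.X ^ j * q) = 0) : q = 0 := by
  by_contra hne
  have h1 := hf.2 (Polynomial.C q.leadingCoeff⁻¹ * q) ((isCharPoly_iff_moment _ _ _).2
    ⟨by rw [mul_comm]; exact Polynomial.monic_mul_leadingCoeff_inv hne, fun i _ => by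
      rw [← Polynomial.smul_eq_C_mul, mul_smul_comm, map_smul, moment_mul_eq_zero_of_lt h,
        smul_zero]⟩)
  rw [Polynomial.natDegree_C_mul (by simpa using hne), hD,
    Polynomial.degree_eq_natDegree hne] at *
  exact absurd (Nat.cast_lt.1 hq) (not_lt.2 h1)

/-- The leading terms of `g` and the characteristic polynomial cancel, and `2 D` terms supply
exactly the `D` vanishing moments needed for the difference. This gives both `f(T) = 0` and the
uniqueness of the minimal polynomial in degree `D`. -/
theorem eq_charpoly {f : K[X]} (hf : IsMinPoly (fun i => r ⬝ᵥ (T ^ i *ᵥ e)) (2 * D) f)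
    (hD : f.natDegree = D) {g : K[X]} (hg : IsCharPoly (fun i => r ⬝ᵥ (T ^ i *ᵥ e)) (2 * D) g)
    (hgD : g.natDegree = D) : g = T.charpoly := by
  refine sub_eq_zero.1 (eq_zero_of_moment_eq_zero hf hD ?_ fun j hj => ?_)
  · refine (Polynomial.degree_sub_lt_left ?_ hg.1.ne_zero ?_).trans_eq ?_
    · rw [Polynomial.degree_eq_natDegree hg.1.ne_zero, hgD,
        Polynomial.degree_eq_natDegree T.charpoly_monic.ne_zero, natDegree_charpoly_fin]
    · rw [hg.1, T.charpoly_monic.leadingCoeff]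
    · rw [Polynomial.degree_eq_natDegree hg.1.ne_zero, hgD]
  · rw [mul_sub, map_sub, mul_comm _ T.charpoly, moment_charpoly_mul,
      ((isCharPoly_iff_moment _ _ _).1 hg).2 j (by omega), sub_zero]

theorem coeff_sum_C_mul_X_pow (c : Fin D → K) (k : ℕ) :
    (∑ k : Fin D, Polynomial.C (c k) * Polynomial.X ^ (k : ℕ)).coeff k =
      if h : k < D then c ⟨k, h⟩ else 0 := by
  simp only [Polynomial.finsetSum_coeff, Polynomial.coeff_C_mul, Polynomial.coeff_X_pow, mul_ite,
    mul_one, mul_zero]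
  split_ifs with h
  · rw [Finset.sum_eq_single ⟨k, h⟩] <;> simp +contextual [Fin.ext_iff, eq_comm]
  · exact Finset.sum_eq_zero fun j _ => if_neg (by have := j.isLt; omega)

theorem degree_sum_C_mul_X_pow_lt (c : Fin D → K) :
    (∑ k : Fin D, Polynomial.C (c k) * Polynomial.X ^ (k : ℕ)).degree < (D : WithBot ℕ) :=
  (Polynomial.degree_lt_iff_coeff_zero _ _).2 fun m hm => by
    rw [coeff_sum_C_mul_X_pow, dif_neg (by omega)]

/-- A kernel vector is the coefficient vector of a polynomial of degree `< D` with vanishing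
moments. -/
theorem isUnit_det_hankel {N : ℕ} {f : K[X]}
    (hf : IsMinPoly (fun i => r ⬝ᵥ (T ^ i *ᵥ e)) N f) (hD : f.natDegree = D) :
    IsUnit (hankel D fun i => r ⬝ᵥ (T ^ i *ᵥ e)).det := by
  rw [isUnit_iff_ne_zero]
  intro h0
  obtain ⟨c, hc, h⟩ := exists_mulVec_eq_zero_iff.2 h0
  have h1 := eq_zero_of_moment_eq_zero hf hD (degree_sum_C_mul_X_pow_lt c) fun j hj => by
    rw [mul_comm, Finset.sum_mul, map_sum]
    refine Eq.trans (Finset.sum_congr rfl fun k _ => ?_) (congrFun h ⟨j, hj⟩)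
    rw [mul_assoc, ← pow_add, ← Polynomial.smul_eq_C_mul, map_smul, moment_krylov,
      Polynomial.aeval_X_pow, smul_eq_mul, mul_comm, add_comm]
    rfl
  refine hc (funext fun k => ?_)
  have := coeff_sum_C_mul_X_pow c k
  rwa [h1, Polynomial.coeff_zero, dif_pos k.isLt, eq_comm] at this

end MinPoly

/-! ### Factorization of the Hankel matrix; coordinates in the quotient ring -/

namespace Input

variable {K : Type u} [Field K] {n : ℕ} [NeZero n] (A : Input.{u, v} K n)

theorem hankel_eq_mul :
    hankel A.D A.seq = (Matrix.of fun j k => A.krylov (j : Fin A.D) k) * krylovMatrix A.T A.e := by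
  ext j k
  change A.r ⬝ᵥ (A.T ^ ((j : ℕ) + k) *ᵥ A.e) =
    (A.Tᵀ ^ (j : ℕ) *ᵥ A.r) ⬝ᵥ (A.T ^ (k : ℕ) *ᵥ A.e)
  rw [transpose_pow_dotProduct, mulVec_mulVec, pow_add]

theorem rhs_eq_mulVec (i : Fin n) :
    A.rhs i = (Matrix.of fun j k => A.krylov (j : Fin A.D) k) *ᵥ A.v i := rfl

variable {A}

/-- The matrix with rows `r_j` is a left factor of both `H` and `b_i`, and cancels. -/
theorem sol_eq (h : IsUnit (hankel A.D A.seq).det) (i : Fin n) :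
    A.sol i = (krylovMatrix A.T A.e)⁻¹ *ᵥ A.v i := by
  rw [sol, rhs_eq_mulVec, mulVec_mulVec, hankel_eq_mul, Matrix.mul_inv_rev, mul_assoc,
    nonsing_inv_mul, mul_one]
  rw [hankel_eq_mul, det_mul] at h
  exact isUnit_of_mul_isUnit_left h

theorem isUnit_det_krylovMatrix (h : IsUnit (hankel A.D A.seq).det) :
    IsUnit (krylovMatrix A.T A.e).det := by
  rw [hankel_eq_mul, det_mul] at h
  exact isUnit_of_mul_isUnit_right h

theorem krylovMatrix_mulVec_sol (h : IsUnit (hankel A.D A.seq).det) (i : Fin n) :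
    krylovMatrix A.T A.e *ᵥ A.sol i = A.v i := by
  rw [sol_eq h, mulVec_mulVec, mul_nonsing_inv _ (isUnit_det_krylovMatrix h), one_mulVec]

variable (A)

theorem ε_injective : Function.Injective A.ε := fun _ _ h =>
  A.strictMono_ε.injective (congrArg A.ord.toSyn h)

theorem ε_mem (k : Fin A.D) : A.ε k ∈ standardMonomials A.ord A.I :=
  A.range_ε ▸ Set.mem_range_self k

theorem zero_mem_standardMonomials : 0 ∈ standardMonomials A.ord A.I := by
  intro p hp hne h0
  refine A.ne_top (Ideal.eq_top_of_isUnit_mem _ hp ?_)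
  rw [A.ord.eq_C_of_degree_eq_zero h0]
  exact (isUnit_iff_ne_zero.2 (A.ord.leadingCoeff_ne_zero_iff.2 hne)).map C

theorem D_pos : 0 < A.D := by
  obtain ⟨k, -⟩ := A.range_ε.symm ▸ A.zero_mem_standardMonomials
  exact k.pos

theorem ε_zero : A.ε ⟨0, A.D_pos⟩ = 0 := by
  obtain ⟨k, hk⟩ := A.range_ε.symm ▸ A.zero_mem_standardMonomials
  have h1 : A.ord.toSyn (A.ε ⟨0, A.D_pos⟩) ≤ A.ord.toSyn (A.ε k) :=
    A.strictMono_ε.monotone (Fin.mk_le_of_le_val (Nat.zero_le _))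
  rw [hk, map_zero] at h1
  exact A.ord.toSyn.injective (by rw [map_zero]; exact le_antisymm h1 (bot_le (a := _)))

/-- The polynomial with given coordinates in the canonical basis. -/
noncomputable def toPoly (w : Fin A.D → K) : MvPolynomial (Fin n) K :=
  ∑ k, monomial (A.ε k) (w k)

theorem coeff_toPoly (w : Fin A.D → K) (k : Fin A.D) : (A.toPoly w).coeff (A.ε k) = w k := by
  classical
  rw [toPoly, coeff_sum, Finset.sum_eq_single k] <;>
    simp +contextual [coeff_monomial, A.ε_injective.eq_iff]

theorem mem_standardMonomials_of_mem_support (w : Fin A.D → K) {s : Fin n →₀ ℕ}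
    (hs : s ∈ (A.toPoly w).support) : s ∈ standardMonomials A.ord A.I := by
  classical
  obtain ⟨k, -, hk⟩ := Finset.mem_biUnion.1 (support_sum hs)
  have := support_monomial_subset hk
  rw [Finset.mem_singleton] at this
  exact this ▸ A.ε_mem k

theorem eq_zero_of_mem_of_support {p : MvPolynomial (Fin n) K} (hp : p ∈ A.I)
    (hs : ∀ s ∈ p.support, s ∈ standardMonomials A.ord A.I) : p = 0 := by
  by_contra hne
  exact hs _ (A.ord.degree_mem_support hne) p hp hne rfl

/-- The element of the quotient ring with given coordinates in the canonical basis. -/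
noncomputable def toQuot : (Fin A.D → K) →ₗ[K] MvPolynomial (Fin n) K ⧸ A.I where
  toFun w := Ideal.Quotient.mk A.I (A.toPoly w)
  map_add' w w' := by simp [toPoly, Finset.sum_add_distrib]
  map_smul' c w := by
    have : A.toPoly (c • w) = c • A.toPoly w := by
      simp [toPoly, Finset.smul_sum, smul_monomial]
    rw [this]
    rfl

theorem toQuot_injective : Function.Injective A.toQuot := by
  rw [← LinearMap.ker_eq_bot, LinearMap.ker_eq_bot']
  intro w hw
  have h := A.eq_zero_of_mem_of_support (Ideal.Quotient.eq_zero_iff_mem.1 hw)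
    fun s => A.mem_standardMonomials_of_mem_support w
  funext k
  rw [← A.coeff_toPoly w k, h]
  simp

/-- Well-founded induction along the term order: a nonstandard monomial leads some `p ∈ I`, hence is
congruent to a combination of smaller monomials. -/
theorem mk_monomial_mem_range (s : Fin n →₀ ℕ) :
    Ideal.Quotient.mk A.I (monomial s (1 : K)) ∈ LinearMap.range A.toQuot := by
  induction hs : A.ord.toSyn s using WellFoundedLT.induction generalizing s with
  | ind y ih =>
    subst hs
    by_cases hst : s ∈ standardMonomials A.ord A.I
    · obtain ⟨k, rfl⟩ := A.range_ε.symm ▸ hst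
      refine ⟨Pi.single k 1, ?_⟩
      change Ideal.Quotient.mk A.I (∑ j, monomial (A.ε j) ((Pi.single k 1 : Fin A.D → K) j)) = _
      rw [Finset.sum_eq_single k] <;> simp +contextual
    · simp only [standardMonomials, Set.mem_ofPred_eq, not_forall, not_not] at hst
      obtain ⟨p, hp, hne, rfl⟩ := hst
      have hc : A.ord.leadingCoeff p ≠ 0 := A.ord.leadingCoeff_ne_zero_iff.2 hne
      have hp0 : ∑ t ∈ p.support,
          p.coeff t • Ideal.Quotient.mk A.I (monomial t (1 : K)) = 0 := by
        rw [← Ideal.Quotient.eq_zero_iff_mem.2 hp]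
        conv_rhs => rw [p.as_sum, map_sum]
        refine Finset.sum_congr rfl fun t _ => ?_
        rw [← mul_one (coeff t p), ← smul_eq_mul, ← smul_monomial]
        simp only [smul_eq_mul, mul_one]
        rfl
      rw [← Finset.add_sum_erase _ _ (A.ord.degree_mem_support hne), add_eq_zero_iff_eq_neg] at hp0
      have h1 : Ideal.Quotient.mk A.I (monomial (A.ord.degree p) (1 : K)) =
          (A.ord.leadingCoeff p)⁻¹ • -∑ t ∈ p.support.erase (A.ord.degree p),
            p.coeff t • Ideal.Quotient.mk A.I (monomial t (1 : K)) := by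
        rw [← hp0, smul_smul, ← MonomialOrder.leadingCoeff, inv_mul_cancel₀ hc, one_smul]
      rw [h1]
      refine Submodule.smul_mem _ _ (Submodule.neg_mem _ (Submodule.sum_mem _ fun t ht =>
        Submodule.smul_mem _ _ (ih _ ?_ t rfl)))
      rw [Finset.mem_erase] at ht
      exact lt_of_le_of_ne (A.ord.le_degree ht.2) fun h => ht.1 (A.ord.toSyn.injective h)

theorem toQuot_surjective : Function.Surjective A.toQuot := by
  rw [← LinearMap.range_eq_top, eq_top_iff]
  rintro x -
  obtain ⟨p, rfl⟩ := Ideal.Quotient.mk_surjective x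
  rw [p.as_sum, map_sum]
  refine Submodule.sum_mem _ fun s _ => ?_
  have := Submodule.smul_mem _ (p.coeff s) (A.mk_monomial_mem_range s)
  convert this using 1
  rw [← mul_one (coeff s p), ← smul_eq_mul, ← smul_monomial, smul_eq_mul, mul_one]
  rfl

theorem finrank_quotient : Module.finrank K (MvPolynomial (Fin n) K ⧸ A.I) = A.D := by
  rw [← (LinearEquiv.ofBijective A.toQuot ⟨A.toQuot_injective, A.toQuot_surjective⟩).finrank_eq]
  simp

theorem toQuot_e : A.toQuot A.e = 1 := by
  change Ideal.Quotient.mk A.I (∑ j, monomial (A.ε j) (A.e j)) = 1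
  rw [Finset.sum_eq_single ⟨0, A.D_pos⟩]
  · rw [ε_zero]; simp [e]
  · intro j _ hj
    rw [e, if_neg, map_zero]
    exact fun h => hj (Fin.ext h)
  · simp

theorem toQuot_v (i : Fin n) : A.toQuot (A.v i) = Ideal.Quotient.mk A.I (X i) :=
  (Ideal.Quotient.eq.2 (A.v_spec i).1).symm

theorem toQuot_T_mulVec (w : Fin A.D → K) :
    A.toQuot (A.T *ᵥ w) = Ideal.Quotient.mk A.I (X 0) * A.toQuot w := by
  suffices h : A.toQuot ∘ₗ A.T.mulVecLin =
      LinearMap.mulLeft K (Ideal.Quotient.mk A.I (X 0)) ∘ₗ A.toQuot from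
    LinearMap.congr_fun h w
  refine (Pi.basisFun K (Fin A.D)).ext fun j => ?_
  simp only [LinearMap.comp_apply, Pi.basisFun_apply, mulVecLin_apply, mulVec_single_one,
    LinearMap.mulLeft_apply]
  have h : A.toQuot (Pi.single j 1) = Ideal.Quotient.mk A.I (monomial (A.ε j) 1) := by
    change Ideal.Quotient.mk A.I (∑ k, monomial (A.ε k) ((Pi.single j 1 : Fin A.D → K) k)) = _
    rw [Finset.sum_eq_single j] <;> simp +contextual
  rw [h, ← map_mul]
  exact (Ideal.Quotient.eq.2 (A.T_spec j).1).symm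

theorem toQuot_aeval_mulVec (p : Polynomial K) (w : Fin A.D → K) :
    A.toQuot (Polynomial.aeval A.T p *ᵥ w) =
      Ideal.Quotient.mk A.I (Polynomial.aeval (X 0) p) * A.toQuot w := by
  induction p using Polynomial.induction_on generalizing w with
  | C a =>
    rw [Polynomial.aeval_C, Polynomial.aeval_C, Algebra.algebraMap_eq_smul_one, smul_mulVec,
      one_mulVec, map_smul]
    exact Algebra.smul_def a (A.toQuot w)
  | add p q hp hq => simp only [map_add, add_mulVec, hp, hq, add_mul]
  | monomial k a h =>
    rw [pow_succ, ← mul_assoc, map_mul, ← mulVec_mulVec, h, Polynomial.aeval_X, toQuot_T_mulVec,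
      map_mul (Polynomial.aeval _) (_ * _) Polynomial.X, map_mul (Ideal.Quotient.mk _) _
      (Polynomial.aeval _ Polynomial.X), Polynomial.aeval_X, mul_assoc]

theorem toQuot_krylovMatrix_mulVec (c : Fin A.D → K) :
    A.toQuot (krylovMatrix A.T A.e *ᵥ c) = Ideal.Quotient.mk A.I
      (Polynomial.aeval (X 0) (∑ k, Polynomial.C (c k) * Polynomial.X ^ (k : ℕ))) := by
  rw [krylovMatrix_mulVec, toQuot_aeval_mulVec, toQuot_e, mul_one]

end Input

/-! ### Shape families and the lexicographic order -/

section Lex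

variable {K : Type u} [Field K] {n : ℕ} [NeZero n]

theorem coeff_aeval_X_zero (q : Polynomial K) (s : Fin n →₀ ℕ) :
    (Polynomial.aeval (X 0 : MvPolynomial (Fin n) K) q).coeff s =
      if s = Finsupp.single 0 (s 0) then q.coeff (s 0) else 0 := by
  classical
  induction q using Polynomial.induction_on' with
  | add p q hp hq => rw [map_add, coeff_add, hp, hq]; split_ifs <;> simp
  | monomial k a =>
    rw [Polynomial.aeval_monomial, MvPolynomial.algebraMap_eq, C_mul_X_pow_eq_monomial,
      coeff_monomial, Polynomial.coeff_monomial]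
    by_cases h : Finsupp.single 0 k = s
    · subst h; simp
    · rw [if_neg h]
      split_ifs with h1 h2
      · exact absurd (h2 ▸ h1.symm) h
      · rfl
      · rfl

theorem lexOrder_lt_single_of_ne_zero {i : Fin n} (hi : i ≠ 0) (k : ℕ) :
    (lexOrder n).toSyn (Finsupp.single 0 k) < (lexOrder n).toSyn (Finsupp.single i 1) := by
  refine Finsupp.Colex.lt_iff.2 ⟨i, fun j hj => ?_, ?_⟩
  · have h0 : (0 : Fin n) ≠ j := ((Fin.zero_le _).trans_lt hj).ne
    change Finsupp.single 0 k j = Finsupp.single i 1 j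
    rw [Finsupp.single_eq_of_ne' h0, Finsupp.single_eq_of_ne' hj.ne]
  · change Finsupp.single 0 k i < Finsupp.single i 1 i
    rw [Finsupp.single_eq_of_ne' hi.symm, Finsupp.single_eq_same]
    exact Nat.one_pos

/-- As `x_1` is the smallest variable, only powers of `x_1` lie below a power of `x_1`; a polynomial
with such a leading monomial is univariate. -/
theorem eq_single_of_lexOrder_le {s : Fin n →₀ ℕ} {k : ℕ}
    (h : (lexOrder n).toSyn s ≤ (lexOrder n).toSyn (Finsupp.single 0 k)) :
    s = Finsupp.single 0 (s 0) ∧ s 0 ≤ k := by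
  rcases h.eq_or_lt with h | h
  · rw [(lexOrder n).toSyn.injective h]; simp
  · obtain ⟨i, hi, hlt⟩ := Finsupp.Colex.lt_iff.1 h
    change ∀ j, i < j → s j = Finsupp.single 0 k j at hi
    change s i < Finsupp.single 0 k i at hlt
    have hi0 : i = 0 := by
      by_contra h0
      rw [Finsupp.single_eq_of_ne h0] at hlt
      exact absurd hlt (Nat.not_lt_zero _)
    subst hi0
    rw [Finsupp.single_eq_same] at hlt
    refine ⟨Finsupp.ext fun j => ?_, hlt.le⟩
    rcases eq_or_ne j 0 with rfl | hj
    · simp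
    · rw [hi j (Fin.pos_iff_ne_zero.2 hj), Finsupp.single_eq_of_ne hj, Finsupp.single_eq_of_ne hj]

theorem degree_aeval_X_zero {q : Polynomial K} (hq : q ≠ 0) :
    (lexOrder n).degree (Polynomial.aeval (X 0 : MvPolynomial (Fin n) K) q) =
      Finsupp.single 0 q.natDegree := by
  refine (lexOrder n).toSyn.injective (le_antisymm ?_ ?_)
  · rw [MonomialOrder.degree_le_iff]
    intro s hs
    rw [mem_support_iff, coeff_aeval_X_zero, ite_ne_right_iff] at hs
    rw [hs.1]
    exact (lexOrder n).toSyn_monotone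
      (Finsupp.single_mono (Polynomial.le_natDegree_of_ne_zero hs.2))
  · refine (lexOrder n).le_degree ?_
    rw [mem_support_iff, coeff_aeval_X_zero]
    simpa using hq

theorem degree_aeval_X_zero_lt {i : Fin n} (hi : i ≠ 0) (q : Polynomial K) :
    (lexOrder n).toSyn ((lexOrder n).degree
      (-Polynomial.aeval (X 0 : MvPolynomial (Fin n) K) q)) <
      (lexOrder n).toSyn ((lexOrder n).degree (X i : MvPolynomial (Fin n) K)) := by
  rw [MonomialOrder.degree_X, MonomialOrder.degree_neg]
  rcases eq_or_ne q 0 with rfl | hq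
  · rw [map_zero, MonomialOrder.degree_zero, ← Finsupp.single_zero (0 : Fin n)]
    exact lexOrder_lt_single_of_ne_zero hi 0
  · rw [degree_aeval_X_zero hq]
    exact lexOrder_lt_single_of_ne_zero hi _

theorem degree_shapeFamily_zero {f₁ : Polynomial K} (f : Fin n → Polynomial K) (h : f₁ ≠ 0) :
    (lexOrder n).degree (shapeFamily f₁ f 0) = Finsupp.single 0 f₁.natDegree := by
  rw [shapeFamily, if_pos rfl, degree_aeval_X_zero h]

theorem degree_shapeFamily_of_ne (f₁ : Polynomial K) (f : Fin n → Polynomial K) {i : Fin n}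
    (hi : i ≠ 0) : (lexOrder n).degree (shapeFamily f₁ f i) = Finsupp.single i 1 := by
  rw [shapeFamily, if_neg hi, sub_eq_add_neg,
    MonomialOrder.degree_add_of_lt (degree_aeval_X_zero_lt hi _), MonomialOrder.degree_X]

theorem monic_shapeFamily {f₁ : Polynomial K} (f : Fin n → Polynomial K) (h : f₁.Monic)
    (i : Fin n) : (lexOrder n).Monic (shapeFamily f₁ f i) := by
  rcases eq_or_ne i 0 with rfl | hi
  · rw [MonomialOrder.Monic, MonomialOrder.leadingCoeff, degree_shapeFamily_zero f h.ne_zero,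
      shapeFamily, if_pos rfl, coeff_aeval_X_zero]
    simpa using h.leadingCoeff
  · rw [shapeFamily, if_neg hi, sub_eq_add_neg]
    exact MonomialOrder.monic_X.add_of_lt (degree_aeval_X_zero_lt hi _)

/-- An ideal containing the shape family, modulo which `1, x_1, …, x_1 ^ (d - 1)` are linearly
independent, has it as reduced Gröbner basis. -/
theorem isReducedGroebnerBasis_shapeFamily {I : Ideal (MvPolynomial (Fin n) K)}
    {f₁ : Polynomial K} {f : Fin n → Polynomial K} (hm : f₁.Monic) (hpos : 0 < f₁.natDegree)
    (hf : ∀ i, (f i).degree < f₁.natDegree) (hI : ∀ i, shapeFamily f₁ f i ∈ I)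
    (hind : ∀ q : Polynomial K, q.degree < f₁.natDegree →
      Polynomial.aeval (X 0 : MvPolynomial (Fin n) K) q ∈ I → q = 0) :
    IsReducedGroebnerBasis (lexOrder n) I (Set.range (shapeFamily f₁ f)) where
  subset := Set.range_subset_iff.2 hI
  monic := Set.forall_mem_range.2 (monic_shapeFamily f hm)
  exists_degree_le p hp hne := by
    rw [Set.exists_range_iff]
    set d := (lexOrder n).degree p with hd
    by_cases h : ∃ i, i ≠ 0 ∧ d i ≠ 0
    · obtain ⟨i, hi, hdi⟩ := h
      refine ⟨i, ?_⟩
      rw [degree_shapeFamily_of_ne _ _ hi, Finsupp.single_le_iff]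
      exact Nat.one_le_iff_ne_zero.2 hdi
    · push Not at h
      have hd0 : d = Finsupp.single 0 (d 0) := by
        ext j
        rcases eq_or_ne j 0 with rfl | hj
        · simp
        · rw [h j hj, Finsupp.single_eq_of_ne hj]
      refine ⟨0, ?_⟩
      rw [degree_shapeFamily_zero _ hm.ne_zero, Finsupp.single_le_iff]
      by_contra! hlt
      have hsupp : ∀ s ∈ p.support, s = Finsupp.single 0 (s 0) ∧ s 0 ≤ d 0 := fun s hs =>
        eq_single_of_lexOrder_le (hd0 ▸ (lexOrder n).le_degree hs)
      -- Now `p` is univariate in `x_1` of degree `< deg f₁`, so independence of the low powers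
      -- modulo `I` forces `p = 0`.
      have hpq : Polynomial.aeval (X 0 : MvPolynomial (Fin n) K)
          (∑ k : Fin f₁.natDegree, Polynomial.C (p.coeff (Finsupp.single 0 (k : ℕ))) *
            Polynomial.X ^ (k : ℕ)) = p := by
        ext s
        rw [coeff_aeval_X_zero, coeff_sum_C_mul_X_pow]
        by_cases hs : s ∈ p.support
        · obtain ⟨h1, h2⟩ := hsupp s hs
          rw [if_pos h1, dif_pos (by omega)]
          exact congrArg (fun t => coeff t p) h1.symm
        · rw [notMem_support_iff.1 hs]
          split_ifs with h1 h2
          · rw [← notMem_support_iff.1 hs]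
            exact congrArg (fun t => coeff t p) h1.symm
          · rfl
          · rfl
      have hq := hind _ (degree_sum_C_mul_X_pow_lt _) (hpq.symm ▸ hp)
      rw [hq, map_zero] at hpq
      exact hne hpq.symm
  reduced := by
    rw [Set.forall_mem_range]
    intro i
    rw [Set.forall_mem_range]
    intro j hne s hs hle
    have hij : j ≠ i := fun h => hne (h ▸ rfl)
    have key : s = Finsupp.single 0 (s 0) ∧ (i ≠ 0 → s 0 < f₁.natDegree) ∨
        i ≠ 0 ∧ s = Finsupp.single i 1 := by
      rw [mem_support_iff, shapeFamily] at hs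
      split_ifs at hs with hi
      · rw [coeff_aeval_X_zero, ite_ne_right_iff] at hs
        exact Or.inl ⟨hs.1, fun h => absurd hi h⟩
      · classical
        rw [coeff_sub, coeff_X, coeff_aeval_X_zero] at hs
        by_cases h1 : Finsupp.single i 1 = s
        · exact Or.inr ⟨hi, h1.symm⟩
        · rw [if_neg h1, zero_sub, neg_ne_zero, ite_ne_right_iff] at hs
          refine Or.inl ⟨hs.1, fun _ => ?_⟩
          by_contra! h2
          exact hs.2 ((Polynomial.degree_lt_iff_coeff_zero _ _).1 (hf i) _ h2)
    rcases eq_or_ne j 0 with rfl | hj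
    · rw [degree_shapeFamily_zero _ hm.ne_zero, Finsupp.single_le_iff] at hle
      rcases key with ⟨-, h⟩ | ⟨hi, h⟩
      · exact absurd (h hij.symm) (not_lt.2 hle)
      · rw [h, Finsupp.single_eq_of_ne' hi] at hle
        omega
    · rw [degree_shapeFamily_of_ne _ _ hj, Finsupp.single_le_iff] at hle
      have : s j = 0 := by
        rcases key with ⟨h, -⟩ | ⟨-, h⟩
        · rw [h, Finsupp.single_eq_of_ne hj]
        · rw [h, Finsupp.single_eq_of_ne hij]
      omega

end Lex

/-! ### Correctness of the returned basis -/

namespace Input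

variable {K : Type u} [Field K] {n : ℕ} [NeZero n] (A : Input.{u, v} K n)

theorem aeval_X_zero_mem (p : Polynomial K) (hp : Polynomial.aeval A.T p = 0) :
    Polynomial.aeval (X 0 : MvPolynomial (Fin n) K) p ∈ A.I := by
  rw [← Ideal.Quotient.eq_zero_iff_mem, ← mul_one (Ideal.Quotient.mk A.I _), ← A.toQuot_e,
    ← toQuot_aeval_mulVec, hp, zero_mulVec, map_zero]

variable {A}

theorem aeval_eq_zero {f : Polynomial K} (hf : IsMinPoly A.seq (2 * A.D) f)
    (hD : f.natDegree = A.D) : Polynomial.aeval A.T f = 0 := by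
  have h : f = A.T.charpoly := eq_charpoly hf hD hf.1 hD
  rw [h, aeval_self_charpoly]

theorem isReducedGroebnerBasis {f : Polynomial K} (hf : IsMinPoly A.seq (2 * A.D) f)
    (hD : f.natDegree = A.D) :
    IsReducedGroebnerBasis (lexOrder n) A.I (Set.range (shapeFamily f A.solPoly)) := by
  have hH : IsUnit (hankel A.D A.seq).det := isUnit_det_hankel hf hD
  have hK := isUnit_det_krylovMatrix hH
  refine isReducedGroebnerBasis_shapeFamily hf.1.1 (hD ▸ A.D_pos)
    (fun i => hD ▸ degree_sum_C_mul_X_pow_lt _) (fun i => ?_) fun q hq hqI => ?_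
  · rw [shapeFamily]
    split_ifs with hi
    · exact A.aeval_X_zero_mem f (aeval_eq_zero hf hD)
    · rw [← Ideal.Quotient.eq_zero_iff_mem, map_sub, solPoly, ← toQuot_krylovMatrix_mulVec,
        krylovMatrix_mulVec_sol hH, toQuot_v, sub_self]
  · rw [hD] at hq
    have hsum : q = ∑ k : Fin A.D, Polynomial.C (q.coeff k) * Polynomial.X ^ (k : ℕ) := by
      ext k
      rw [coeff_sum_C_mul_X_pow fun k : Fin A.D => q.coeff k]
      split_ifs with h
      · rfl
      · exact (Polynomial.degree_lt_iff_coeff_zero _ _).1 hq k (not_lt.1 h)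
    rw [hsum, ← Ideal.Quotient.eq_zero_iff_mem, ← toQuot_krylovMatrix_mulVec,
      map_eq_zero_iff _ A.toQuot_injective] at hqI
    have h0 := eq_zero_of_mulVec_eq_zero hK.ne_zero hqI
    rw [hsum]
    exact Finset.sum_eq_zero fun k _ => by rw [congrFun h0 k]; simp

end Input
-- Frame conditions and loop rules for programs
section Machine

variable {K : Type u}

/-- Passing from `s` to `s'` changes only the natural-number arrays in `cs` and the field arrays in
`fs`, at the cost of at most `k` field operations. -/
structure Changes (cs fs : List ℕ) (k : ℕ) (s s' : State K) : Prop where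
  nat : ∀ a, a ∉ cs → s'.nat a = s.nat a
  fld : ∀ a, a ∉ fs → s'.fld a = s.fld a
  ops : s'.ops ≤ s.ops + k

namespace Changes

variable {cs cs' fs fs' : List ℕ} {k k' : ℕ} {s s' s'' : State K}

theorem refl (s : State K) : Changes cs fs k s s := ⟨fun _ _ => rfl, fun _ _ => rfl, by omega⟩

theorem trans (h : Changes cs fs k s s') (h' : Changes cs fs k' s' s'') :
    Changes cs fs (k + k') s s'' where
  nat a ha := (h'.nat a ha).trans (h.nat a ha)
  fld a ha := (h'.fld a ha).trans (h.fld a ha)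
  ops := by have := h.ops; have := h'.ops; omega

theorem mono (h : Changes cs fs k s s') (hc : cs ⊆ cs') (hf : fs ⊆ fs') (hk : k ≤ k') :
    Changes cs' fs' k' s s' where
  nat a ha := h.nat a fun h => ha (hc h)
  fld a ha := h.fld a fun h => ha (hf h)
  ops := by have := h.ops; omega

end Changes

theorem update_self {α : Type u} (μ : ℕ → ℕ → α) (a i : ℕ) (x : α) : update μ a i x a i = x := by
  simp [update]

theorem update_of_ne {α : Type u} (μ : ℕ → ℕ → α) {a b : ℕ} (h : b ≠ a) (i : ℕ) (x : α) :
    update μ a i x b = μ b := by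
  funext j; simp [update, h]

theorem update_apply {α : Type u} (μ : ℕ → ℕ → α) (a i j : ℕ) (x : α) :
    update μ a i x a j = if j = i then x else μ a j := by
  simp [update]

theorem update_update {α : Type u} (μ : ℕ → ℕ → α) (a i : ℕ) (x y : α) :
    update (update μ a i x) a i y = update μ a i y := by
  funext b j; simp only [update]; split_ifs <;> rfl

theorem update_eq_of_eq {μ ν : ℕ → ℕ → ℕ} {t : ℕ}
    (h : ∀ p, update μ t 0 p = update ν t 0 p) {a : ℕ} (ha : a ≠ t) : μ a = ν a := by
  rw [← update_of_ne μ ha 0 0, h, update_of_ne ν ha]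

variable [Field K] [DecidableEq K]

theorem iter_induction {α : Type u} {g : ℕ → α → α} (P : ℕ → α → Prop) {s : α} (h0 : P 0 s)
    {N : ℕ} (hs : ∀ q < N, ∀ s', P q s' → P (q + 1) (g q s')) : P N (iter g N s) := by
  induction N with
  | zero => exact h0
  | succ N ih => exact hs N (Nat.lt_succ_self N) _ (ih fun q hq => hs q (hq.trans N.lt_succ_self))

/-- Loop rule: the invariant `P` is preserved by each pass, which costs at most `k`. -/
theorem run_loop {cs fs : List ℕ} {k t N : ℕ} {x : NExpr} {c : Prog} {s : State K}
    (P : ℕ → State K → Prop) (hN : x.eval s.nat = N) (ht : t ∈ cs) (h0 : P 0 s)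
    (hP : ∀ q s', P q s' → P q { s' with nat := update s'.nat t 0 q })
    (hs : ∀ q < N, ∀ s', Changes cs fs (q * k) s s' → s'.nat t 0 = q → P q s' →
      Changes cs fs k s' (c.run s') ∧ P (q + 1) (c.run s')) :
    Changes cs fs (N * k) s ((Prog.loop t x c).run s) ∧ P N ((Prog.loop t x c).run s) := by
  rw [Prog.run, hN]
  refine iter_induction (fun q s' => Changes cs fs (q * k) s s' ∧ P q s') ⟨.refl s, h0⟩ ?_
  rintro q hq s' ⟨h1, h2⟩
  have h3 : Changes cs fs (q * k) s { s' with nat := update s'.nat t 0 q } :=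
    ⟨fun a ha => (update_of_ne _ (ne_of_mem_of_not_mem ht ha).symm _ _).trans (h1.nat a ha),
      h1.fld, h1.ops⟩
  obtain ⟨h4, h5⟩ := hs q hq _ h3 (update_self _ _ _ _) (hP q s' h2)
  exact ⟨(h3.trans h4).mono (List.Subset.refl _) (List.Subset.refl _)
    (by rw [Nat.succ_mul]), h5⟩

/-- Add `x * y` for `x` in cell `j` of array `b` and `y` in cell `k` of array `c` to cell `i` of
array `a`, in a loop with counter `t`. -/
def macLoop (t : ℕ) (x : NExpr) (a : ℕ) (i : NExpr) (b : ℕ) (j : NExpr) (c : ℕ) (k : NExpr) :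
    Prog :=
  .loop t x (.seq (.opF .mul 8 (.const 0) b j c k) (.opF .add a i a i 8 (.const 0)))

/-- The last two hypotheses allow the target array to be a source as well, provided that no cell
read is ever written; each pass then sees the original values. Several passes may hit the same
target cell, hence the sum. Array `8` is scratch. -/
theorem run_macLoop {t : ℕ} {x : NExpr} {a : ℕ} {i : NExpr} {b : ℕ} {j : NExpr} {c : ℕ} {k : NExpr}
    {s : State K} {N : ℕ} (I J M : ℕ → ℕ) (hx : x.eval s.nat = N)
    (hi : ∀ p < N, i.eval (update s.nat t 0 p) = I p)
    (hj : ∀ p < N, j.eval (update s.nat t 0 p) = J p)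
    (hk : ∀ p < N, k.eval (update s.nat t 0 p) = M p)
    (ha : a ≠ 8) (hb : b ≠ 8) (hc : c ≠ 8)
    (hab : a = b → ∀ p < N, ∀ q < N, I q ≠ J p)
    (hac : a = c → ∀ p < N, ∀ q < N, I q ≠ M p) :
    Changes [t] [a, 8] (2 * N) s ((macLoop t x a i b j c k).run s) ∧
      ∀ m, ((macLoop t x a i b j c k).run s).fld a m =
        s.fld a m + ∑ p ∈ Finset.range N, if I p = m then s.fld b (J p) * s.fld c (M p) else 0 := by
  rw [macLoop, Prog.run, hx]
  -- Index memory is compared after overwriting the counter: this expresses that only the counter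
  -- cell changed, in the form in which index expressions are evaluated.
  suffices h : ∀ q ≤ N, ∀ s', s' = iter (fun q s' => ((Prog.opF FOp.mul 8 (.const 0) b j c k).seq
      (Prog.opF FOp.add a i a i 8 (.const 0))).run { s' with nat := update s'.nat t 0 q }) q s →
      (∀ p, update s'.nat t 0 p = update s.nat t 0 p) ∧
      (∀ f, f ≠ a → f ≠ 8 → s'.fld f = s.fld f) ∧ s'.ops = s.ops + 2 * q ∧
      ∀ m, s'.fld a m = s.fld a m +
        ∑ p ∈ Finset.range q, if I p = m then s.fld b (J p) * s.fld c (M p) else 0 by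
    obtain ⟨h1, h2, h3, h4⟩ := h N le_rfl _ rfl
    refine ⟨⟨fun f hf => update_eq_of_eq h1 (by simpa using hf), fun f hf => ?_, h3.le⟩, h4⟩
    simp only [List.mem_cons, List.not_mem_nil, or_false, not_or] at hf
    exact h2 f hf.1 hf.2
  intro q
  induction q with
  | zero => rintro - s' rfl; exact ⟨fun _ => rfl, fun _ _ _ => rfl, rfl, by simp⟩
  | succ q ih =>
    rintro hq s' rfl
    obtain ⟨h1, h2, h3, h4⟩ := ih (by omega) _ rfl
    rw [iter]
    set s1 := iter _ q s with hs1
    have hJ : s1.fld b (J q) = s.fld b (J q) := by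
      by_cases h : a = b
      · subst h
        rw [h4, Finset.sum_eq_zero, add_zero]
        intro p hp
        rw [if_neg (hab rfl q hq p (by have := Finset.mem_range.1 hp; omega))]
      · rw [h2 b (Ne.symm h) hb]
    have hM : s1.fld c (M q) = s.fld c (M q) := by
      by_cases h : a = c
      · subst h
        rw [h4, Finset.sum_eq_zero, add_zero]
        intro p hp
        rw [if_neg (hac rfl q hq p (by have := Finset.mem_range.1 hp; omega))]
      · rw [h2 c (Ne.symm h) hc]
    simp only [Prog.run, h1, hi q hq, hj q hq, hk q hq, NExpr.eval, FOp.eval, update_self,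
      update_of_ne _ ha, hJ, hM]
    refine ⟨fun p => by rw [update_update], fun f hf hf8 => ?_, by rw [h3]; ring, fun m => ?_⟩
    · rw [update_of_ne _ hf, update_of_ne _ hf8, h2 f hf hf8]
    · rw [update_apply, Finset.sum_range_succ, ← add_assoc, ← h4 m]
      by_cases hm : m = I q
      · subst hm; rw [if_pos rfl, if_pos rfl]
      · rw [if_neg hm, if_neg (Ne.symm hm), add_zero, update_of_ne _ ha]

/-- Copy cell `j` of array `b` to cell `i` of array `a`, in a loop with counter `t`. -/
def copyLoop (t : ℕ) (x : NExpr) (a : ℕ) (i : NExpr) (b : ℕ) (j : NExpr) : Prog :=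
  .loop t x (.copyF a i b j)

theorem run_copyLoop {t : ℕ} {x : NExpr} {a : ℕ} {i : NExpr} {b : ℕ} {j : NExpr}
    {s : State K} {N d : ℕ} (J : ℕ → ℕ) (hx : x.eval s.nat = N)
    (hi : ∀ p < N, i.eval (update s.nat t 0 p) = p + d)
    (hj : ∀ p < N, j.eval (update s.nat t 0 p) = J p) (hab : b ≠ a) :
    Changes [t] [a] 0 s ((copyLoop t x a i b j).run s) ∧
      ∀ m, ((copyLoop t x a i b j).run s).fld a m =
        if d ≤ m ∧ m < N + d then s.fld b (J (m - d)) else s.fld a m := by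
  rw [copyLoop, Prog.run, hx]
  suffices h : ∀ q ≤ N, ∀ s', s' = iter (fun q s' => (Prog.copyF a i b j).run
      { s' with nat := update s'.nat t 0 q }) q s →
      (∀ p, update s'.nat t 0 p = update s.nat t 0 p) ∧
      (∀ f, f ≠ a → s'.fld f = s.fld f) ∧ s'.ops = s.ops ∧
      ∀ m, s'.fld a m = if d ≤ m ∧ m < q + d then s.fld b (J (m - d)) else s.fld a m by
    obtain ⟨h1, h2, h3, h4⟩ := h N le_rfl _ rfl
    exact ⟨⟨fun f hf => update_eq_of_eq h1 (by simpa using hf),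
      fun f hf => h2 f (by simpa using hf), h3.le⟩, h4⟩
  intro q
  induction q with
  | zero =>
    rintro - s' rfl
    exact ⟨fun _ => rfl, fun _ _ => rfl, rfl, fun m => by rw [if_neg (by omega)]⟩
  | succ q ih =>
    rintro hq s' rfl
    obtain ⟨h1, h2, h3, h4⟩ := ih (by omega) _ rfl
    rw [iter]
    set s1 := iter _ q s with hs1
    simp only [Prog.run, h1, hi q hq, hj q hq]
    refine ⟨fun p => by rw [update_update], fun f hf => ?_, h3, fun m => ?_⟩
    · rw [update_of_ne _ hf, h2 f hf]
    · rw [update_apply, h2 b hab, h4]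
      by_cases hm : m = q + d
      · subst hm; rw [if_pos rfl, if_pos (by omega), Nat.add_sub_cancel]
      · rw [if_neg hm]
        exact if_congr (by omega) rfl rfl

end Machine

section Sums

variable {K : Type u} [Field K]

theorem mul_add_inj {D i j i' j' : ℕ} (hj : j < D) (hj' : j' < D) (h : i * D + j = i' * D + j') :
    i = i' ∧ j = j' := by
  have h1 : (i * D + j) / D = i := by
    rw [mul_comm, Nat.mul_add_div (by omega), Nat.div_eq_of_lt hj, add_zero]
  have h2 : (i' * D + j') / D = i' := by
    rw [mul_comm, Nat.mul_add_div (by omega), Nat.div_eq_of_lt hj', add_zero]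
  have h3 : i = i' := by rw [← h1, h, h2]
  subst h3
  exact ⟨rfl, by omega⟩

/-- A sum over the positions of a duplicate-free list that contains the support of `G`. -/
theorem sum_range_length {α : Type*} [Fintype α] {l : List α} (hl : l.Nodup)
    {F : ℕ → K} {G : α → K} (hF : ∀ p (hp : p < l.length), F p = G l[p])
    (hG : ∀ x, x ∉ l → G x = 0) : ∑ p ∈ Finset.range l.length, F p = ∑ x, G x := by
  classical
  rw [Finset.sum_range, ← Finset.sum_subset (Finset.subset_univ l.toFinset)
    (fun x _ hx => hG x (by simpa using hx)), List.sum_toFinset _ hl, ← List.sum_ofFn]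
  congr 1
  refine List.ext_getElem (by simp) fun p h1 h2 => ?_
  simp only [List.getElem_ofFn, List.getElem_map]
  exact hF p _

theorem getD_map {α β : Type*} (l : List α) (f : α → β) (d : β) {p : ℕ} (hp : p < l.length) :
    (l.map f).getD p d = f l[p] := by
  simp [List.getD_eq_getElem?_getD, hp]

/-- A loop writing with offset `e` multiplies a polynomial by `X^e`; nothing is lost if the
coefficients vanish beyond the loop bound. -/
theorem sum_range_shift (N e m : ℕ) (F : ℕ → K) (hF : ∀ p, N ≤ p → F p = 0) :
    (∑ p ∈ Finset.range N, if p + e = m then F p else 0) = if e ≤ m then F (m - e) else 0 := by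
  split_ifs with h
  · by_cases hm : m - e < N
    · rw [Finset.sum_eq_single (m - e)]
      · rw [if_pos (by omega)]
      · intro p _ hp
        rw [if_neg (by omega)]
      · intro h1
        exact absurd (Finset.mem_range.2 hm) h1
    · rw [hF _ (not_lt.1 hm)]
      refine Finset.sum_eq_zero fun p hp => if_neg ?_
      have := Finset.mem_range.1 hp
      omega
  · exact Finset.sum_eq_zero fun p _ => if_neg (by omega)

end Sums
-- The program
section Programs

/-- Cell `0` of a natural-number array. -/
def NExpr.head (a : ℕ) : NExpr := .get a (.const 0)

/-- The size of the matrix. -/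
def dimE : NExpr := .get 0 (.const 1)

/-- The position `i * D + j`. -/
def posE (i j : NExpr) : NExpr := .add (.mul i dimE) j

/-- Add the product of the transposed matrix and row `t` of array `a` to row `t + 1`, where `t` is
the counter `10`. -/
def mulTransposeProg (a : ℕ) : Prog :=
  macLoop 11 (.get 0 (.const 2)) a (posE (.add (.head 10) (.const 1)) (.get 2 (.head 11)))
    0 (.head 11) a (posE (.head 10) (.get 1 (.head 11)))

/-- Computation of the vectors `r_i`. -/
def krylovProg : Prog :=
  .seq (copyLoop 10 dimE 3 (.head 10) 1 (.head 10))
    -- This also produces `r_(2D)`, one vector more than the method asks for, since `dualProg` runs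
    -- over `2 D + 1` coefficients.
    (.loop 10 (.add dimE dimE) (mulTransposeProg 3))

/-- Computation of the sequence. -/
def seqProg : Prog :=
  copyLoop 10 (.add dimE dimE) 4 (.head 10) 3 (.mul (.head 10) dimE)

/-- The bound `2 D + 1` for loops over the coefficients of a polynomial. -/
def coeffE : NExpr := .add (.add dimE dimE) (.const 1)

/-- The shift `N + 1 - 2 L`, where `N` is the counter `10`. -/
def shiftE : NExpr := .sub (.add (.head 10) (.const 1)) (.add (.head 6) (.head 6))

/-- The shift `2 L - (N + 1)`, where `N` is the counter `10`. -/
def shiftE' : NExpr := .sub (.add (.head 6) (.head 6)) (.add (.head 10) (.const 1))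

/-- Computation of `IsBerlekampMassey.next`. -/
def nextProg : Prog :=
  -- In field array `10`, cell `1` holds `b`, cell `2` the discrepancy `d`, cell `3` the factor
  -- `-d/b`, and later cell `4` holds `1/b`. Arrays `5` and `9` hold `g` and `h`; array `13` saves
  -- the old `g`.
  .seq (.setF 10 (.const 3) false) <|
  .seq (.opF .sub 10 (.const 3) 10 (.const 3) 10 (.const 2)) <|
  .seq (.opF .div 10 (.const 3) 10 (.const 3) 10 (.const 1)) <|
  .seq (copyLoop 11 coeffE 13 (.head 11) 5 (.head 11)) <|
  -- Array `15` is never written and stays zero, so this clears `g`.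
  .seq (copyLoop 11 coeffE 5 (.head 11) 15 (.head 11)) <|
  .seq (copyLoop 11 coeffE 5 (.add (.head 11) shiftE) 13 (.head 11))
    (macLoop 11 coeffE 5 (.add (.head 11) shiftE') 10 (.const 3) 9 (.head 11))

/-- Change of the length in the Berlekamp–Massey algorithm. -/
def lengthProg : Prog :=
  .ifN shiftE .skip <|
    .seq (copyLoop 11 coeffE 9 (.head 11) 13 (.head 11)) <|
    .seq (.copyF 10 (.const 1) 10 (.const 2))
      (.setN 6 (.const 0) (.sub (.add (.head 10) (.const 1)) (.head 6)))

/-- Computation of the discrepancy in the Berlekamp–Massey algorithm. -/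
def discrepancyProg : Prog :=
  .seq (.setF 10 (.const 2) false)
    (macLoop 11 coeffE 10 (.const 2) 5 (.head 11) 4 (.add (.sub (.head 10) (.head 6)) (.head 11)))

/-- One step of the Berlekamp–Massey algorithm. -/
def berlekampMasseyStep : Prog :=
  .seq discrepancyProg (.ifF 10 (.const 2) .skip (.seq nextProg lengthProg))

/-- The Berlekamp–Massey algorithm. -/
def berlekampMasseyProg : Prog :=
  .seq (.setF 5 (.const 0) true) <|
  .seq (.setF 10 (.const 1) true)
    (.loop 10 (.add dimE dimE) berlekampMasseyStep)

/-- Computation of the vector dual to `T ^ (D - 1) e` with respect to the Krylov basis. -/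
def dualProg : Prog :=
  .seq (.setF 10 (.const 4) true) <|
  .seq (.opF .div 10 (.const 4) 10 (.const 4) 10 (.const 1)) <|
  .seq (macLoop 11 coeffE 14 (.head 11) 9 (.head 11) 10 (.const 4))
    (.loop 10 coeffE
      (macLoop 11 dimE 11 (.head 11) 14 (.head 10) 3 (posE (.head 10) (.head 11))))

/-- The transposed Horner scheme. -/
def hornerProg : Prog :=
  .loop 10 dimE <| .seq (mulTransposeProg 12)
    (macLoop 11 dimE 12 (posE (.add (.head 10) (.const 1)) (.head 11))
      5 (.sub dimE (.head 10)) 11 (.head 11))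

/-- Computation of the right-hand sides and the solutions of the Hankel systems. -/
def solveProg : Prog :=
  .loop 10 (.get 0 (.const 3)) <|
    .seq (macLoop 11 dimE 6 (posE (.get 3 (.head 10)) (.head 11))
        2 (.head 10) 3 (posE (.head 11) (.get 4 (.head 10))))
      (macLoop 11 dimE 7 (posE (.get 3 (.head 10)) (.head 11))
        2 (.head 10) 12 (posE (.sub dimE (.head 11)) (.get 4 (.head 10))))

/-- The Wiedemann/Hankel method. -/
def wiedemannProg : Prog :=
  .seq krylovProg <| .seq seqProg <| .seq berlekampMasseyProg <|
    -- With truncated subtraction this sum is zero exactly when `L = D`.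
    .ifN (.add (.sub (.head 6) dimE) (.sub dimE (.head 6)))
      (.seq dualProg <| .seq hornerProg <| .seq solveProg <|
        .setN 5 (.const 0) (.const 1))
      .skip

end Programs

/-! ### Sparse products, the Krylov vectors and the sequence -/

section Loaded

variable {K : Type u} [Field K] {n : ℕ} [NeZero n]

/-- The input is still in memory. -/
structure Loaded (A : Input.{u, v} K n) (l : List (Fin A.D × Fin A.D)) (w : List (Fin n × Fin A.D))
    (s : State K) : Prop where
  nat : ∀ a < 5, s.nat a = (A.initState l w).nat a
  fld : ∀ a < 3, s.fld a = (A.initState l w).fld a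

namespace Loaded

variable {A : Input.{u, v} K n} {l : List (Fin A.D × Fin A.D)} {w : List (Fin n × Fin A.D)}
  {s s' : State K}

theorem of_changes (h : Loaded A l w s) {cs fs : List ℕ} {k : ℕ} (hs : Changes cs fs k s s')
    (hc : ∀ a ∈ cs, 5 ≤ a) (hf : ∀ a ∈ fs, 3 ≤ a) : Loaded A l w s' where
  nat a ha := (hs.nat a fun h => absurd (hc a h) (not_le.2 ha)).trans (h.nat a ha)
  fld a ha := (hs.fld a fun h => absurd (hf a h) (not_le.2 ha)).trans (h.fld a ha)

theorem dim (h : Loaded A l w s) : s.nat 0 1 = A.D := by rw [h.nat 0 (by decide)]; rfl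

theorem length_l (h : Loaded A l w s) : s.nat 0 2 = l.length := by
  rw [h.nat 0 (by decide)]; rfl

theorem length_w (h : Loaded A l w s) : s.nat 0 3 = w.length := by
  rw [h.nat 0 (by decide)]; rfl

theorem row (h : Loaded A l w s) {p : ℕ} (hp : p < l.length) : s.nat 1 p = l[p].1 := by
  rw [h.nat 1 (by decide)]; exact getD_map l _ _ hp

theorem col (h : Loaded A l w s) {p : ℕ} (hp : p < l.length) : s.nat 2 p = l[p].2 := by
  rw [h.nat 2 (by decide)]; exact getD_map l _ _ hp

theorem entry (h : Loaded A l w s) {p : ℕ} (hp : p < l.length) :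
    s.fld 0 p = A.T l[p].1 l[p].2 := by
  rw [h.fld 0 (by decide)]; exact getD_map l _ _ hp

theorem var (h : Loaded A l w s) {p : ℕ} (hp : p < w.length) : s.nat 3 p = w[p].1 := by
  rw [h.nat 3 (by decide)]; exact getD_map w _ _ hp

theorem coord (h : Loaded A l w s) {p : ℕ} (hp : p < w.length) : s.nat 4 p = w[p].2 := by
  rw [h.nat 4 (by decide)]; exact getD_map w _ _ hp

theorem coord_entry (h : Loaded A l w s) {p : ℕ} (hp : p < w.length) :
    s.fld 2 p = A.v w[p].1 w[p].2 := by
  rw [h.fld 2 (by decide)]; exact getD_map w _ _ hp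

theorem vec (h : Loaded A l w s) (j : Fin A.D) : s.fld 1 j = A.r j := by
  rw [h.fld 1 (by decide)]
  change (List.ofFn A.r).getD j 0 = A.r j
  simp [List.getD_eq_getElem?_getD]

end Loaded

variable [DecidableEq K] {A : Input.{u, v} K n} {l : List (Fin A.D × Fin A.D)}
  {w : List (Fin n × Fin A.D)} {s : State K}

theorem run_mulTransposeProg (hl : A.IsSparseT l) {a t : ℕ} (ha : a ≠ 8) (ha0 : a ≠ 0)
    (h : Loaded A l w s) (ht : s.nat 10 0 = t)
    {x : Fin A.D → K} (hx : ∀ j : Fin A.D, s.fld a (t * A.D + j) = x j) :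
    Changes [11] [a, 8] (2 * l.length) s ((mulTransposeProg a).run s) ∧
      (∀ j : Fin A.D, ((mulTransposeProg a).run s).fld a ((t + 1) * A.D + j) =
        s.fld a ((t + 1) * A.D + j) + (A.Tᵀ *ᵥ x) j) ∧
      ∀ m, (m < (t + 1) * A.D ∨ (t + 2) * A.D ≤ m) →
        ((mulTransposeProg a).run s).fld a m = s.fld a m := by
  have hrow : ∀ p < l.length, s.nat 1 p < A.D := fun p hp => h.row hp ▸ Fin.isLt _
  have hcol : ∀ p < l.length, s.nat 2 p < A.D := fun p hp => h.col hp ▸ Fin.isLt _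
  obtain ⟨h1, h2⟩ := run_macLoop (s := s) (t := 11) (x := .get 0 (.const 2)) (a := a)
    (i := posE (.add (.head 10) (.const 1)) (.get 2 (.head 11)))
    (b := 0) (j := .head 11) (c := a) (k := posE (.head 10) (.get 1 (.head 11)))
    (N := l.length) (fun p => (t + 1) * A.D + s.nat 2 p) (fun p => p)
    (fun p => t * A.D + s.nat 1 p) h.length_l
    (fun p _ => by simp [posE, dimE, NExpr.eval, NExpr.head, update, h.dim, ht])
    (fun p _ => by simp [NExpr.eval, NExpr.head, update])
    (fun p _ => by simp [posE, dimE, NExpr.eval, NExpr.head, update, h.dim, ht])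
    ha (by decide) ha (fun h => absurd h ha0)
    -- Row `t` is read and row `t + 1` is written, so the accumulation within one array is safe.
    (fun _ p hp q hq he => by
      have := (mul_add_inj (hcol q hq) (hrow p hp) he).1
      omega)
  refine ⟨h1, fun j => ?_, fun m hm => ?_⟩
  · rw [mulTransposeProg, h2, sum_range_length hl.1
      (G := fun p => if p.2 = j then A.T p.1 p.2 * x p.1 else 0), Fintype.sum_prod_type_right,
      Finset.sum_eq_single j]
    · simp [mulVec, dotProduct]
    · intro k _ hk
      simp [hk]
    · simp
    · intro p hp
      rw [h.row hp, h.col hp, h.entry hp, hx]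
      refine if_congr ⟨fun he => ?_, fun he => by rw [he]⟩ rfl rfl
      exact Fin.ext (mul_add_inj (Fin.isLt _) j.isLt he).2
    · intro p hp
      have : A.T p.1 p.2 = 0 := by
        by_contra hne
        exact hp ((hl.2 p).2 hne)
      simp [this]
  · rw [mulTransposeProg, h2, Finset.sum_eq_zero, add_zero]
    intro p hp
    have hp := hcol p (Finset.mem_range.1 hp)
    refine if_neg fun he => ?_
    have h3 : (t + 2) * A.D = (t + 1) * A.D + A.D := by ring
    omega

theorem run_krylovProg (hl : A.IsSparseT l) (h : Loaded A l w s) (h0 : s.fld 3 = 0) :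
    Changes [10, 11] [3, 8] (2 * A.D * (2 * l.length)) s (krylovProg.run s) ∧
      ∀ i ≤ 2 * A.D, ∀ j : Fin A.D, (krylovProg.run s).fld 3 (i * A.D + j) = A.krylov i j := by
  obtain ⟨h1, h2⟩ := run_copyLoop (s := s) (t := 10) (x := dimE) (a := 3) (i := .head 10) (b := 1)
    (j := .head 10) (N := A.D) (d := 0) (fun p => p) h.dim
    (fun p _ => by simp [NExpr.eval, NExpr.head, update])
    (fun p _ => by simp [NExpr.eval, NExpr.head, update]) (by decide)
  rw [krylovProg, Prog.run]
  set s1 := (copyLoop 10 dimE 3 (.head 10) 1 (.head 10)).run s with hs1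
  have hL : Loaded A l w s1 := h.of_changes h1 (by decide) (by decide)
  obtain ⟨h3, h4⟩ := run_loop (cs := [10, 11]) (fs := [3, 8]) (k := 2 * l.length) (t := 10)
    (N := 2 * A.D) (x := .add dimE dimE) (c := mulTransposeProg 3) (s := s1)
    (fun q s' => (∀ i ≤ q, ∀ j : Fin A.D, s'.fld 3 (i * A.D + j) = A.krylov i j) ∧
      ∀ m, (q + 1) * A.D ≤ m → s'.fld 3 m = 0)
    (by simp [NExpr.eval, dimE, hL.dim, two_mul]) (by decide)
    ⟨fun i hi j => by
      obtain rfl : i = 0 := by omega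
      rw [h2, if_pos ⟨by omega, by have := j.isLt; omega⟩]
      simpa [Input.krylov] using h.vec j,
    fun m hm => by rw [h2, if_neg (by omega), h0]; rfl⟩
    (fun q s' h => h)
    (fun q hq s' hs hc ⟨h5, h6⟩ => by
      obtain ⟨h7, h8, h9⟩ := run_mulTransposeProg (s := s') (a := 3) hl (by decide) (by decide)
        (hL.of_changes hs (by decide) (by decide)) hc (h5 q le_rfl)
      refine ⟨h7.mono (by decide) (by decide) le_rfl, fun i hi j => ?_, fun m hm => ?_⟩
      · rcases Nat.lt_or_eq_of_le hi with hi | rfl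
        · rw [h9 _ (Or.inl ?_), h5 i (by omega)]
          have h10 : i * A.D ≤ q * A.D := Nat.mul_le_mul_right _ (by omega)
          have h11 : (q + 1) * A.D = q * A.D + A.D := by ring
          have := j.isLt
          omega
        · rw [h8, h6 _ (by omega), zero_add, Input.krylov, Input.krylov, pow_succ',
            ← mulVec_mulVec]
      · rw [h9 _ (Or.inr hm), h6]
        exact le_trans (Nat.mul_le_mul_right _ (by omega)) hm)
  exact ⟨((h1.mono (by decide) (by decide) le_rfl).trans h3).mono (by decide) (by decide)
    (by omega), h4.1⟩

theorem run_seqProg (h : Loaded A l w s)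
    (hk : ∀ i ≤ 2 * A.D, ∀ j : Fin A.D, s.fld 3 (i * A.D + j) = A.krylov i j) :
    Changes [10] [4] 0 s (seqProg.run s) ∧
      ∀ i < 2 * A.D, (seqProg.run s).fld 4 i = A.seq i := by
  obtain ⟨h1, h2⟩ := run_copyLoop (s := s) (t := 10) (x := .add dimE dimE) (a := 4) (i := .head 10)
    (b := 3) (j := .mul (.head 10) dimE) (N := 2 * A.D) (d := 0) (fun p => p * A.D)
    (by simp [NExpr.eval, dimE, h.dim, two_mul])
    (fun p _ => by simp [NExpr.eval, NExpr.head, update])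
    (fun p _ => by simp [NExpr.eval, NExpr.head, dimE, update, h.dim]) (by decide)
  refine ⟨h1, fun i hi => ?_⟩
  have h3 := hk i hi.le ⟨0, A.D_pos⟩
  rw [Fin.val_mk, add_zero] at h3
  rw [seqProg, h2, if_pos ⟨by omega, by omega⟩, Nat.sub_zero, h3]
  -- Since `e` is the first unit vector, `s_i` is the first entry of `r_i` and costs no operation.
  have h4 : A.e = Pi.single ⟨0, A.D_pos⟩ 1 := by
    funext k
    simp [Input.e, Pi.single_apply, Fin.ext_iff]
  rw [Input.seq, ← transpose_pow_dotProduct, h4, dotProduct_single, mul_one]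
  rfl

end Loaded
-- Effect and cost of single instructions
section Basic

variable {K : Type u} [Field K] [DecidableEq K]

theorem changes_setF (a : ℕ) (i : NExpr) (o : Bool) (s : State K) :
    Changes [] [a] 0 s ((Prog.setF a i o).run s) :=
  ⟨fun _ _ => rfl, fun _ hf => update_of_ne _ (by simpa using hf) _ _, le_rfl⟩

theorem changes_copyF (a : ℕ) (i : NExpr) (b : ℕ) (j : NExpr) (s : State K) :
    Changes [] [a] 0 s ((Prog.copyF a i b j).run s) :=
  ⟨fun _ _ => rfl, fun _ hf => update_of_ne _ (by simpa using hf) _ _, le_rfl⟩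

theorem changes_opF (o : FOp) (a : ℕ) (i : NExpr) (b : ℕ) (j : NExpr) (c : ℕ) (k : NExpr)
    (s : State K) : Changes [] [a] 1 s ((Prog.opF o a i b j c k).run s) :=
  ⟨fun _ _ => rfl, fun _ hf => update_of_ne _ (by simpa using hf) _ _, le_rfl⟩

theorem changes_setN (a : ℕ) (i x : NExpr) (s : State K) :
    Changes [a] [] 0 s ((Prog.setN a i x).run s) :=
  ⟨fun _ hf => update_of_ne _ (by simpa using hf) _ _, fun _ _ => rfl, le_rfl⟩

theorem run_setF_fld (a : ℕ) (i : NExpr) (o : Bool) (s : State K) :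
    ((Prog.setF a i o).run s).fld a (i.eval s.nat) = if o then 1 else 0 := by
  rw [Prog.run]; exact update_self _ _ _ _

theorem run_copyF_fld (a : ℕ) (i : NExpr) (b : ℕ) (j : NExpr) (s : State K) :
    ((Prog.copyF a i b j).run s).fld a (i.eval s.nat) = s.fld b (j.eval s.nat) := by
  rw [Prog.run]; exact update_self _ _ _ _

theorem run_opF_fld (o : FOp) (a : ℕ) (i : NExpr) (b : ℕ) (j : NExpr) (c : ℕ) (k : NExpr)
    (s : State K) : ((Prog.opF o a i b j c k).run s).fld a (i.eval s.nat) =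
      o.eval (s.fld b (j.eval s.nat)) (s.fld c (k.eval s.nat)) := by
  rw [Prog.run]; exact update_self _ _ _ _

theorem run_setN_nat (a : ℕ) (i x : NExpr) (s : State K) :
    ((Prog.setN a i x).run s).nat a (i.eval s.nat) = x.eval s.nat := by
  rw [Prog.run]; exact update_self _ _ _ _

end Basic

/-! ### Berlekamp–Massey on the machine -/

section BerlekampMassey

variable {K : Type u} [Field K] {D q L : ℕ} {S : ℕ → K} {g h : Polynomial K} {b : K}
  {s : State K}

/-- The memory represents the state of the Berlekamp–Massey algorithm for the sequence `S`. -/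
structure Represents (D : ℕ) (S : ℕ → K) (L : ℕ) (g h : Polynomial K) (b : K) (s : State K) :
    Prop where
  dim : s.nat 0 1 = D
  seq : ∀ i < 2 * D, s.fld 4 i = S i
  length : s.nat 6 0 = L
  poly : ∀ k, s.fld 5 k = g.coeff k
  aux : ∀ k, s.fld 9 k = h.coeff k
  disc : s.fld 10 1 = b
  zero : ∀ k, s.fld 15 k = 0

theorem Represents.of_changes {s' : State K} {g' : Polynomial K} (H : Represents D S L g h b s)
    {cs fs : List ℕ} {k : ℕ} (hs : Changes cs fs k s s') (hc : ∀ a ∈ cs, 10 ≤ a)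
    (hf : ∀ a ∈ fs, a ∈ [5, 8, 10, 13]) (hb : s'.fld 10 1 = b)
    (hg : ∀ k, s'.fld 5 k = g'.coeff k) : Represents D S L g' h b s' where
  dim := by rw [hs.nat 0 fun h => absurd (hc _ h) (by decide), H.dim]
  seq i hi := by rw [hs.fld 4 fun h => absurd (hf _ h) (by decide), H.seq i hi]
  length := by rw [hs.nat 6 fun h => absurd (hc _ h) (by decide), H.length]
  poly := hg
  aux k := by rw [hs.fld 9 fun h => absurd (hf _ h) (by decide), H.aux k]
  disc := hb
  zero k := by rw [hs.fld 15 fun h => absurd (hf _ h) (by decide), H.zero k]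

variable [DecidableEq K]

theorem run_discrepancyProg (H : Represents D S L g h b s) (hq : s.nat 10 0 = q) (hqD : q < 2 * D)
    (B : IsBerlekampMassey S q L g h b) :
    Changes [11] [10, 8] (2 * (2 * D + 1)) s (discrepancyProg.run s) ∧
      (discrepancyProg.run s).fld 10 1 = b ∧
      (discrepancyProg.run s).fld 10 2 = moment S (Polynomial.X ^ (q - L) * g) := by
  rw [discrepancyProg, Prog.run]
  have h1 := changes_setF 10 (.const 2) false s
  have h10 : ∀ m, ((Prog.setF 10 (.const 2) false).run s).fld 10 m =
      if m = 2 then 0 else s.fld 10 m := fun m => update_apply _ _ _ _ _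
  set s1 := (Prog.setF 10 (.const 2) false).run s
  have hd : s1.nat 0 1 = D := H.dim
  have hL : s1.nat 6 0 = L := H.length
  have hq1 : s1.nat 10 0 = q := hq
  obtain ⟨h2, h3⟩ := run_macLoop (s := s1) (t := 11) (x := coeffE) (a := 10) (i := .const 2)
    (b := 5) (j := .head 11) (c := 4) (k := .add (.sub (.head 10) (.head 6)) (.head 11))
    (N := 2 * D + 1) (fun _ => 2) (fun p => p) (fun p => q - L + p)
    (by simp [coeffE, dimE, NExpr.eval, hd, two_mul])
    (fun p _ => rfl)
    (fun p _ => by simp [NExpr.eval, NExpr.head, update])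
    (fun p _ => by simp [NExpr.eval, NExpr.head, update, hq1, hL])
    (by decide) (by decide) (by decide) (fun h => absurd h (by decide))
    (fun h => absurd h (by decide))
  refine ⟨((h1.mono (by decide) (by decide) le_rfl).trans h2).mono (by decide) (by decide)
    (by omega), ?_, ?_⟩
  · rw [h3, h10, if_neg (by decide), H.disc]
    simp
  · rw [h3, h10, if_pos rfl, zero_add,
      moment_eq_sum S (m := 2 * D + 1) (by rw [B.natDegree]; have := B.le; omega)]
    refine Finset.sum_congr rfl fun p _ => ?_
    rw [if_pos rfl, h1.fld 5 (by decide), h1.fld 4 (by decide), H.poly]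
    -- Beyond index `L` the coefficient of `g` is zero, so it does not matter that the loop may read
    -- past the `2 D` known terms.
    by_cases hp : p ≤ L
    · rw [H.seq _ (by have := B.le; omega)]
    · rw [Polynomial.coeff_eq_zero_of_natDegree_lt (by rw [B.natDegree]; omega), zero_mul, zero_mul]

theorem run_nextProg (H : Represents D S L g h b s) (hq : s.nat 10 0 = q) (hqD : q < 2 * D)
    (B : IsBerlekampMassey S q L g h b) {d : K} (hd : s.fld 10 2 = d) :
    Changes [11] [5, 8, 10, 13] (2 * (2 * D + 1) + 2) s (nextProg.run s) ∧
      (nextProg.run s).fld 10 1 = b ∧ (nextProg.run s).fld 10 2 = d ∧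
      (∀ k ≤ 2 * D, (nextProg.run s).fld 13 k = g.coeff k) ∧
      ∀ k, (nextProg.run s).fld 5 k = (IsBerlekampMassey.next q L g h b d).coeff k := by
  have hg : ∀ k, 2 * D + 1 ≤ k → g.coeff k = 0 := fun k hk =>
    Polynomial.coeff_eq_zero_of_natDegree_lt (by rw [B.natDegree]; have := B.le; omega)
  have hh : ∀ k, 2 * D + 1 ≤ k → h.coeff k = 0 := fun k hk =>
    Polynomial.coeff_eq_zero_of_natDegree_lt (by have := B.natDegree_add_le; omega)
  simp only [nextProg, Prog.run.eq_2]
  have h1 := changes_setF 10 (.const 3) false s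
  have e1 : ∀ m, ((Prog.setF 10 (.const 3) false).run s).fld 10 m =
      if m = 3 then 0 else s.fld 10 m := fun m => update_apply _ _ _ _ _
  set s1 := (Prog.setF 10 (.const 3) false).run s
  have h2 := changes_opF .sub 10 (.const 3) 10 (.const 3) 10 (.const 2) s1
  have e2 : ∀ m, ((Prog.opF .sub 10 (.const 3) 10 (.const 3) 10 (.const 2)).run s1).fld 10 m =
      if m = 3 then s1.fld 10 3 - s1.fld 10 2 else s1.fld 10 m := fun m => update_apply _ _ _ _ _
  set s2 := (Prog.opF .sub 10 (.const 3) 10 (.const 3) 10 (.const 2)).run s1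
  have h3 := changes_opF .div 10 (.const 3) 10 (.const 3) 10 (.const 1) s2
  have e3 : ∀ m, ((Prog.opF .div 10 (.const 3) 10 (.const 3) 10 (.const 1)).run s2).fld 10 m =
      if m = 3 then s2.fld 10 3 / s2.fld 10 1 else s2.fld 10 m := fun m => update_apply _ _ _ _ _
  set s3 := (Prog.opF .div 10 (.const 3) 10 (.const 3) 10 (.const 1)).run s2
  have c3 := ((h1.trans h2).trans h3).mono (cs' := [11]) (fs' := [10]) (by decide)
    (by decide) le_rfl
  have q1 : s3.fld 10 1 = b := by simp [e3, e2, e1, H.disc]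
  have q2 : s3.fld 10 2 = d := by simp [e3, e2, e1, hd]
  have q3 : s3.fld 10 3 = (0 - d) / b := by simp [e3, e2, e1, H.disc, hd]
  have hN : ∀ s' : State K, s'.nat 0 1 = D → coeffE.eval s'.nat = 2 * D + 1 := fun s' h => by
    simp [coeffE, dimE, NExpr.eval, h, two_mul]
  have d3 : s3.nat 0 1 = D := (c3.nat 0 (by decide) ▸ H.dim)
  obtain ⟨h4, e4⟩ := run_copyLoop (s := s3) (t := 11) (x := coeffE) (a := 13) (i := .head 11)
    (b := 5) (j := .head 11) (N := 2 * D + 1) (d := 0) (fun p => p) (hN _ d3)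
    (fun p _ => by simp [NExpr.eval, NExpr.head, update])
    (fun p _ => by simp [NExpr.eval, NExpr.head, update]) (by decide)
  set s4 := (copyLoop 11 coeffE 13 (.head 11) 5 (.head 11)).run s3
  have d4 : s4.nat 0 1 = D := by rw [h4.nat 0 (by decide), d3]
  obtain ⟨h5, e5⟩ := run_copyLoop (s := s4) (t := 11) (x := coeffE) (a := 5) (i := .head 11)
    (b := 15) (j := .head 11) (N := 2 * D + 1) (d := 0) (fun p => p) (hN _ d4)
    (fun p _ => by simp [NExpr.eval, NExpr.head, update])
    (fun p _ => by simp [NExpr.eval, NExpr.head, update]) (by decide)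
  set s5 := (copyLoop 11 coeffE 5 (.head 11) 15 (.head 11)).run s4
  have c5 := ((c3.mono (List.Subset.refl _) (fs' := [5, 10, 13]) (by decide) le_rfl).trans
    ((h4.mono (by decide) (fs' := [5, 10, 13]) (by decide) le_rfl).trans
    (h5.mono (by decide) (fs' := [5, 10, 13]) (by decide) le_rfl)))
  have d5 : s5.nat 0 1 = D := by rw [h5.nat 0 (by decide), d4]
  have l5 : s5.nat 6 0 = L := by rw [c5.nat 6 (by decide), H.length]
  have n5 : s5.nat 10 0 = q := by rw [c5.nat 10 (by decide), hq]
  obtain ⟨h6, e6⟩ := run_copyLoop (s := s5) (t := 11) (x := coeffE) (a := 5)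
    (i := .add (.head 11) shiftE) (b := 13) (j := .head 11) (N := 2 * D + 1) (d := q + 1 - 2 * L)
    (fun p => p) (hN _ d5)
    (fun p _ => by simp [shiftE, NExpr.eval, NExpr.head, update, l5, n5, two_mul])
    (fun p _ => by simp [NExpr.eval, NExpr.head, update]) (by decide)
  set s6 := (copyLoop 11 coeffE 5 (.add (.head 11) shiftE) 13 (.head 11)).run s5
  have d6 : s6.nat 0 1 = D := by rw [h6.nat 0 (by decide), d5]
  have l6 : s6.nat 6 0 = L := by rw [h6.nat 6 (by decide), l5]
  have n6 : s6.nat 10 0 = q := by rw [h6.nat 10 (by decide), n5]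
  obtain ⟨h7, e7⟩ := run_macLoop (s := s6) (t := 11) (x := coeffE) (a := 5)
    (i := .add (.head 11) shiftE') (b := 10) (j := .const 3) (c := 9) (k := .head 11)
    (N := 2 * D + 1) (fun p => p + (2 * L - (q + 1))) (fun _ => 3) (fun p => p) (hN _ d6)
    (fun p _ => by simp [shiftE', NExpr.eval, NExpr.head, update, l6, n6, two_mul])
    (fun p _ => rfl)
    (fun p _ => by simp [NExpr.eval, NExpr.head, update])
    (by decide) (by decide) (by decide) (fun h => absurd h (by decide))
    (fun h => absurd h (by decide))
  set s7 := (macLoop 11 coeffE 5 (.add (.head 11) shiftE') 10 (.const 3) 9 (.head 11)).run s6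
  have c7 := (c5.mono (List.Subset.refl _) (fs' := [5, 8, 10, 13]) (by decide) le_rfl).trans
    ((h6.mono (List.Subset.refl _) (fs' := [5, 8, 10, 13]) (by decide) le_rfl).trans
    (h7.mono (List.Subset.refl _) (fs' := [5, 8, 10, 13]) (by decide) le_rfl))
  have a10 : s6.fld 10 = s3.fld 10 := by
    rw [h6.fld 10 (by decide), h5.fld 10 (by decide), h4.fld 10 (by decide)]
  have a13 : ∀ k, k < 2 * D + 1 → s5.fld 13 k = g.coeff k := fun k hk => by
    rw [h5.fld 13 (by decide), e4, if_pos ⟨by omega, hk⟩, Nat.sub_zero, c3.fld 5 (by decide),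
      H.poly]
  have a5 : ∀ k, s5.fld 5 k = 0 := fun k => by
    rw [e5]
    split_ifs with hk
    · rw [h4.fld 15 (by decide), c3.fld 15 (by decide), H.zero]
    · rw [h4.fld 5 (by decide), c3.fld 5 (by decide), H.poly, hg k (by omega)]
  refine ⟨c7.mono (List.Subset.refl _) (List.Subset.refl _) (by omega), ?_, ?_, fun k hk => ?_,
    fun k => ?_⟩
  · rw [h7.fld 10 (by decide), a10, q1]
  · rw [h7.fld 10 (by decide), a10, q2]
  · rw [h7.fld 13 (by decide), h6.fld 13 (by decide), a13 k (by omega)]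
  · rw [e7, e6, a10, q3, h6.fld 9 (by decide), c5.fld 9 (by decide),
      sum_range_shift _ _ _ (fun p => (0 - d) / b * s.fld 9 p)
      (fun p hp => by rw [H.aux, hh p hp, mul_zero]), IsBerlekampMassey.next,
      Polynomial.coeff_add, Polynomial.coeff_C_mul, Polynomial.coeff_X_pow_mul',
      Polynomial.coeff_X_pow_mul', mul_ite, mul_zero, H.aux, a5]
    congr 1
    by_cases h1 : q + 1 - 2 * L ≤ k
    · by_cases h2 : k < 2 * D + 1 + (q + 1 - 2 * L)
      · rw [if_pos ⟨h1, h2⟩, if_pos h1, a13 _ (by omega)]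
      · rw [if_neg fun h => h2 h.2, if_pos h1, hg _ (by omega)]
    · rw [if_neg fun h => h1 h.1, if_neg h1]

/-- The cost `8 D + 7` is `4 D + 2` for the discrepancy, `1` for its zero test and `4 D + 4` for the
update; changing the length only copies. -/
theorem run_berlekampMasseyStep (H : Represents D S L g h b s) (hq : s.nat 10 0 = q)
    (hqD : q < 2 * D) (B : IsBerlekampMassey S q L g h b) :
    Changes [6, 10, 11] [5, 8, 9, 10, 13] (8 * D + 7) s (berlekampMasseyStep.run s) ∧
      ∃ L' g' h' b', Represents D S L' g' h' b' (berlekampMasseyStep.run s) ∧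
        IsBerlekampMassey S (q + 1) L' g' h' b' := by
  obtain ⟨h1, h2, h3⟩ := run_discrepancyProg H hq hqD B
  rw [berlekampMasseyStep, Prog.run]
  set s1 := discrepancyProg.run s
  have H1 : Represents D S L g h b s1 := H.of_changes h1 (by decide) (by decide) h2 fun k => by
    rw [h1.fld 5 (by decide), H.poly]
  have hq1 : s1.nat 10 0 = q := by rw [h1.nat 10 (by decide), hq]
  rw [Prog.run]
  have h4 : Changes [] [] 1 s1 { s1 with ops := s1.ops + 1 } :=
    ⟨fun _ _ => rfl, fun _ _ => rfl, le_rfl⟩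
  have H2 : Represents D S L g h b { s1 with ops := s1.ops + 1 } :=
    ⟨H1.dim, H1.seq, H1.length, H1.poly, H1.aux, H1.disc, H1.zero⟩
  have hq2 : { s1 with ops := s1.ops + 1 }.nat 10 0 = q := hq1
  have hd2 : { s1 with ops := s1.ops + 1 }.fld 10 2 = s1.fld 10 2 := rfl
  have c2 := (h1.mono (cs' := [6, 10, 11]) (fs' := [5, 8, 9, 10, 13]) (by decide) (by decide)
    le_rfl).trans (h4.mono (by simp) (by simp) le_rfl)
  set s2 : State K := { s1 with ops := s1.ops + 1 }
  split_ifs with hd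
  · rw [Prog.run]
    exact ⟨c2.mono (List.Subset.refl _) (List.Subset.refl _) (by omega), L, g, h, b, H2,
      B.step_of_eq_zero (h3.symm.trans hd)⟩
  · rw [Prog.run]
    obtain ⟨h5, h6, h7, h8, h9⟩ := run_nextProg H2 hq2 hqD B hd2
    rw [h3] at h9
    set s3 := nextProg.run s2
    have H3 := H2.of_changes h5 (by decide) (by decide) h6 h9
    have hq3 : s3.nat 10 0 = q := by rw [h5.nat 10 (by decide), hq2]
    have c3 := c2.trans (h5.mono (cs' := [6, 10, 11]) (fs' := [5, 8, 9, 10, 13]) (by decide)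
      (by decide) le_rfl)
    have hE : shiftE.eval s3.nat = q + 1 - 2 * L := by
      simp [shiftE, NExpr.eval, NExpr.head, hq3, H3.length, two_mul]
    rw [lengthProg, Prog.run, hE]
    split_ifs with hz
    · exact ⟨c3.mono (List.Subset.refl _) (List.Subset.refl _) (by omega), L, _, h, b, H3,
        B.step_of_le (by omega)⟩
    · rw [Prog.run, Prog.run]
      obtain ⟨k1, k2⟩ := run_copyLoop (s := s3) (t := 11) (x := coeffE) (a := 9) (i := .head 11)
        (b := 13) (j := .head 11) (N := 2 * D + 1) (d := 0) (fun p => p)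
        (by simp [coeffE, dimE, NExpr.eval, H3.dim, two_mul])
        (fun p _ => by simp [NExpr.eval, NExpr.head, update])
        (fun p _ => by simp [NExpr.eval, NExpr.head, update]) (by decide)
      set s4 := (copyLoop 11 coeffE 9 (.head 11) 13 (.head 11)).run s3
      have k3 := changes_copyF 10 (.const 1) 10 (.const 2) s4
      have k4 : ((Prog.copyF 10 (.const 1) 10 (.const 2)).run s4).fld 10 1 = s4.fld 10 2 :=
        run_copyF_fld _ _ _ _ _
      set s5 := (Prog.copyF 10 (.const 1) 10 (.const 2)).run s4
      have k5 := changes_setN 6 (.const 0) (.sub (.add (.head 10) (.const 1)) (.head 6)) s5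
      have k6 : ((Prog.setN 6 (.const 0) (.sub (.add (.head 10) (.const 1)) (.head 6))).run
          s5).nat 6 0 = s5.nat 10 0 + 1 - s5.nat 6 0 := run_setN_nat _ _ _ _
      set s6 := (Prog.setN 6 (.const 0) (.sub (.add (.head 10) (.const 1)) (.head 6))).run s5
      have c6 := (k1.mono (cs' := [6, 11]) (fs' := [9, 10]) (by decide) (by decide) le_rfl).trans
        ((k3.mono (cs' := [6, 11]) (fs' := [9, 10]) (by decide) (by decide) le_rfl).trans
        (k5.mono (cs' := [6, 11]) (fs' := [9, 10]) (by decide) (by decide) le_rfl))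
      refine ⟨(c3.trans (c6.mono (by decide) (by decide) le_rfl)).mono (List.Subset.refl _)
        (List.Subset.refl _) (by omega), _, _, g, _,
        { dim := ?_, seq := fun i hi => ?_, length := ?_, poly := fun k => ?_, aux := fun k => ?_,
          disc := ?_, zero := fun k => ?_ }, B.step_of_lt (by omega) (h3 ▸ hd)⟩
      · rw [c6.nat 0 (by decide), H3.dim]
      · rw [c6.fld 4 (by decide), H3.seq i hi]
      · rw [k6, k3.nat 10 (by decide), k3.nat 6 (by decide), k1.nat 10 (by decide),
          k1.nat 6 (by decide), hq3, H3.length]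
      · rw [c6.fld 5 (by decide), H3.poly]
      · rw [k5.fld 9 (by decide), k3.fld 9 (by decide), k2]
        split_ifs with hk
        · rw [Nat.sub_zero, h8 k (by omega)]
        · rw [H3.aux, Polynomial.coeff_eq_zero_of_natDegree_lt
            (by have := B.natDegree_add_le; omega), Polynomial.coeff_eq_zero_of_natDegree_lt
            (by rw [B.natDegree]; have := B.le; omega)]
      · rw [k5.fld 10 (by decide), k4, k1.fld 10 (by decide), h7, h3]
      · rw [c6.fld 15 (by decide), H3.zero]

theorem run_berlekampMasseyProg (hD : s.nat 0 1 = D) (hS : ∀ i < 2 * D, s.fld 4 i = S i)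
    (hL : s.nat 6 0 = 0) (h5 : s.fld 5 = 0) (h9 : s.fld 9 = 0) (h15 : s.fld 15 = 0) :
    Changes [6, 10, 11] [5, 8, 9, 10, 13] (2 * D * (8 * D + 7)) s (berlekampMasseyProg.run s) ∧
      ∃ L g h b, Represents D S L g h b (berlekampMasseyProg.run s) ∧
        IsBerlekampMassey S (2 * D) L g h b := by
  rw [berlekampMasseyProg, Prog.run, Prog.run]
  have h1 := changes_setF 5 (.const 0) true s
  have e1 : ∀ m, ((Prog.setF 5 (.const 0) true).run s).fld 5 m =
      if m = 0 then 1 else s.fld 5 m := fun m => update_apply _ _ _ _ _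
  set s1 := (Prog.setF 5 (.const 0) true).run s
  have h2 := changes_setF 10 (.const 1) true s1
  have e2 : ((Prog.setF 10 (.const 1) true).run s1).fld 10 1 = 1 := run_setF_fld _ _ _ _
  set s2 := (Prog.setF 10 (.const 1) true).run s1
  have c2 := (h1.mono (cs' := []) (fs' := [5, 10]) (by decide) (by decide) le_rfl).trans
    (h2.mono (cs' := []) (fs' := [5, 10]) (by decide) (by decide) le_rfl)
  have H2 : Represents D S 0 1 0 1 s2 :=
    { dim := by rw [c2.nat 0 (by decide), hD]
      seq := fun i hi => by rw [c2.fld 4 (by decide), hS i hi]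
      length := by rw [c2.nat 6 (by decide), hL]
      poly := fun k => by
        rw [h2.fld 5 (by decide), e1, h5, Polynomial.coeff_one]; rfl
      aux := fun k => by rw [c2.fld 9 (by decide), h9]; rfl
      disc := e2
      zero := fun k => by rw [c2.fld 15 (by decide), h15]; rfl }
  obtain ⟨h3, h4⟩ := run_loop (cs := [6, 10, 11]) (fs := [5, 8, 9, 10, 13]) (k := 8 * D + 7)
    (t := 10) (N := 2 * D) (x := .add dimE dimE) (c := berlekampMasseyStep) (s := s2)
    (fun q s' => ∃ L g h b, Represents D S L g h b s' ∧ IsBerlekampMassey S q L g h b)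
    (by simp [NExpr.eval, dimE, H2.dim, two_mul]) (by decide)
    ⟨0, 1, 0, 1, H2, .init S⟩
    (fun q s' ⟨L, g, h, b, H, B⟩ => ⟨L, g, h, b,
      { H with
        dim := (congrFun (update_of_ne s'.nat (a := 10) (b := 0) (by decide) 0 q) 1).trans H.dim
        length := (congrFun (update_of_ne s'.nat (a := 10) (b := 6) (by decide) 0 q) 0).trans
          H.length }, B⟩)
    (fun q hq s' _ hc ⟨L, g, h, b, H, B⟩ => run_berlekampMasseyStep H hc hq B)
  exact ⟨((c2.mono (by decide) (by decide) le_rfl).trans h3).mono (List.Subset.refl _)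
    (List.Subset.refl _) (by omega), h4⟩

end BerlekampMassey
-- The dual basis and the solutions on the machine
section Success

variable {K : Type u} [Field K] {n : ℕ} [NeZero n] [DecidableEq K] {A : Input.{u, v} K n}
  {l : List (Fin A.D × Fin A.D)} {w : List (Fin n × Fin A.D)} {s : State K}

theorem run_dualProg (h : Loaded A l w s) {g : Polynomial K} {b : K}
    (hdeg : g.natDegree ≤ 2 * A.D)
    (hk : ∀ i ≤ 2 * A.D, ∀ j : Fin A.D, s.fld 3 (i * A.D + j) = A.krylov i j)
    (haux : ∀ k, s.fld 9 k = g.coeff k) (hb : s.fld 10 1 = b)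
    (h11 : s.fld 11 = 0) (h14 : s.fld 14 = 0) :
    Changes [10, 11] [8, 10, 11, 14] (1 + 2 * (2 * A.D + 1) + (2 * A.D + 1) * (2 * A.D)) s
        (dualProg.run s) ∧
      ∀ j : Fin A.D, (dualProg.run s).fld 11 j =
        ∑ k ∈ Finset.range (2 * A.D + 1), g.coeff k * (1 / b) * A.krylov k j := by
  simp only [dualProg, Prog.run.eq_2]
  have h1 := changes_setF 10 (.const 4) true s
  have e1 : ((Prog.setF 10 (.const 4) true).run s).fld 10 4 = 1 := run_setF_fld _ _ _ _
  have e1' : ((Prog.setF 10 (.const 4) true).run s).fld 10 1 = s.fld 10 1 :=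
    (update_apply s.fld 10 4 1 (1 : K)).trans (if_neg (by decide))
  set s1 := (Prog.setF 10 (.const 4) true).run s
  have h2 := changes_opF .div 10 (.const 4) 10 (.const 4) 10 (.const 1) s1
  have e2 : ((Prog.opF .div 10 (.const 4) 10 (.const 4) 10 (.const 1)).run s1).fld 10 4 =
      s1.fld 10 4 / s1.fld 10 1 := run_opF_fld _ _ _ _ _ _ _ _
  set s2 := (Prog.opF .div 10 (.const 4) 10 (.const 4) 10 (.const 1)).run s1
  have c2 := h1.trans h2
  have L2 : Loaded A l w s2 := h.of_changes c2 (by decide) (by decide)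
  obtain ⟨h3, e3⟩ := run_macLoop (s := s2) (t := 11) (x := coeffE) (a := 14) (i := .head 11)
    (b := 9) (j := .head 11) (c := 10) (k := .const 4) (N := 2 * A.D + 1) (fun p => p)
    (fun p => p) (fun _ => 4)
    (by simp [coeffE, dimE, NExpr.eval, L2.dim, two_mul])
    (fun p _ => by simp [NExpr.eval, NExpr.head, update])
    (fun p _ => by simp [NExpr.eval, NExpr.head, update])
    (fun p _ => rfl)
    (by decide) (by decide) (by decide) (fun h => absurd h (by decide))
    (fun h => absurd h (by decide))
  set s3 := (macLoop 11 coeffE 14 (.head 11) 9 (.head 11) 10 (.const 4)).run s2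
  have L3 : Loaded A l w s3 := L2.of_changes h3 (by decide) (by decide)
  have c3 := (c2.mono (cs' := [11]) (fs' := [8, 10, 14]) (by decide) (by decide) le_rfl).trans
    (h3.mono (List.Subset.refl _) (fs' := [8, 10, 14]) (by decide) le_rfl)
  have e14 : ∀ k, s3.fld 14 k = g.coeff k * (1 / b) := fun k => by
    have hs := sum_range_shift (2 * A.D + 1) 0 k (fun p => g.coeff p * (1 / b)) (fun p hp => by
      rw [Polynomial.coeff_eq_zero_of_natDegree_lt (by omega), zero_mul])
    rw [if_pos (Nat.zero_le _), Nat.sub_zero] at hs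
    rw [e3, c2.fld 14 (by decide), h14, ← hs, c2.fld 9 (by decide)]
    simp only [haux, e2, e1, e1', hb, Pi.zero_apply, zero_add, add_zero]
  obtain ⟨h4, e4⟩ := run_loop (cs := [10, 11]) (fs := [8, 11]) (k := 2 * A.D) (t := 10)
    (N := 2 * A.D + 1) (x := coeffE) (s := s3)
    (c := macLoop 11 dimE 11 (.head 11) 14 (.head 10) 3 (posE (.head 10) (.head 11)))
    (fun q s' => ∀ j : Fin A.D, s'.fld 11 j =
      ∑ k ∈ Finset.range q, g.coeff k * (1 / b) * A.krylov k j)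
    (by simp [coeffE, dimE, NExpr.eval, L3.dim, two_mul]) (by decide)
    (fun j => by rw [c3.fld 11 (by decide), h11]; rfl) (fun q s' h => h)
    (fun q hq s' hs hc h5 => by
      have L' := L3.of_changes hs (by decide) (by decide)
      obtain ⟨h6, h7⟩ := run_macLoop (s := s') (t := 11) (x := dimE) (a := 11) (i := .head 11)
        (b := 14) (j := .head 10) (c := 3) (k := posE (.head 10) (.head 11)) (N := A.D)
        (fun p => p) (fun _ => q) (fun p => q * A.D + p) L'.dim
        (fun p _ => by simp [NExpr.eval, NExpr.head, update])
        (fun p _ => by simp [NExpr.eval, NExpr.head, update, hc])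
        (fun p _ => by simp [posE, dimE, NExpr.eval, NExpr.head, update, hc, L'.dim])
        (by decide) (by decide) (by decide) (fun h => absurd h (by decide))
        (fun h => absurd h (by decide))
      refine ⟨h6.mono (by decide) (by decide) le_rfl, fun j => ?_⟩
      rw [h7, h5, Finset.sum_range_succ,
        Finset.sum_eq_single (s := Finset.range A.D) (j : ℕ), if_pos rfl,
        hs.fld 14 (by decide), e14, hs.fld 3 (by decide), c3.fld 3 (by decide), hk q (by omega)]
      · intro p _ hp
        exact if_neg hp
      · intro hj
        exact absurd (Finset.mem_range.2 j.isLt) hj)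
  exact ⟨((c3.mono (by decide) (by decide) le_rfl).trans
    (h4.mono (List.Subset.refl _) (by decide) le_rfl)).mono (List.Subset.refl _)
    (List.Subset.refl _) (by omega), e4⟩

theorem run_hornerProg (hl : A.IsSparseT l) (h : Loaded A l w s) {a : ℕ → K} {x : Fin A.D → K}
    (ha : ∀ k, s.fld 5 k = a k) (hx : ∀ j : Fin A.D, s.fld 11 j = x j) (h12 : s.fld 12 = 0) :
    Changes [10, 11] [8, 12] (A.D * (2 * l.length + 2 * A.D)) s (hornerProg.run s) ∧
      ∀ t ≤ A.D, ∀ j : Fin A.D,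
        (hornerProg.run s).fld 12 (t * A.D + j) = horner A.T a x t j := by
  obtain ⟨h1, h2⟩ := run_loop (cs := [10, 11]) (fs := [8, 12]) (k := 2 * l.length + 2 * A.D)
    (t := 10) (N := A.D) (x := dimE) (s := s)
    (c := .seq (mulTransposeProg 12)
      (macLoop 11 dimE 12 (posE (.add (.head 10) (.const 1)) (.head 11))
      5 (.sub dimE (.head 10)) 11 (.head 11)))
    (fun q s' => (∀ t ≤ q, ∀ j : Fin A.D, s'.fld 12 (t * A.D + j) = horner A.T a x t j) ∧
      ∀ m, (q + 1) * A.D ≤ m → s'.fld 12 m = 0)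
    h.dim (by decide)
    ⟨fun i hi j => by rw [Nat.le_zero.1 hi, h12]; rfl, fun m _ => by rw [h12]; rfl⟩
    (fun q s' h => h)
    (fun q hq s' hs hc ⟨h3, h4⟩ => by
      have L' := h.of_changes hs (by decide) (by decide)
      obtain ⟨h5, h6, h7⟩ := run_mulTransposeProg (s := s') (a := 12) hl (by decide) (by decide)
        L' hc (h3 q le_rfl)
      rw [Prog.run]
      set s1 := (mulTransposeProg 12).run s'
      have L1 := L'.of_changes h5 (by decide) (by decide)
      have hc1 : s1.nat 10 0 = q := by rw [h5.nat 10 (by decide), hc]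
      obtain ⟨h8, h9⟩ := run_macLoop (s := s1) (t := 11) (x := dimE) (a := 12)
        (i := posE (.add (.head 10) (.const 1)) (.head 11))
        (b := 5) (j := .sub dimE (.head 10)) (c := 11) (k := .head 11) (N := A.D)
        (fun p => (q + 1) * A.D + p) (fun _ => A.D - q) (fun p => p) L1.dim
        (fun p _ => by simp [posE, dimE, NExpr.eval, NExpr.head, update, hc1, L1.dim])
        (fun p _ => by simp [dimE, NExpr.eval, NExpr.head, update, hc1, L1.dim])
        (fun p _ => by simp [NExpr.eval, NExpr.head, update])
        (by decide) (by decide) (by decide) (fun h => absurd h (by decide))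
        (fun h => absurd h (by decide))
      have h10 : ∀ m, (m < (q + 1) * A.D ∨ (q + 2) * A.D ≤ m) →
          ((macLoop 11 dimE 12 (posE (.add (.head 10) (.const 1)) (.head 11))
            5 (.sub dimE (.head 10)) 11 (.head 11)).run s1).fld 12 m = s'.fld 12 m := by
        intro m hm
        rw [h9, h7 m hm, Finset.sum_eq_zero, add_zero]
        intro p hp
        have hp := Finset.mem_range.1 hp
        refine if_neg fun he => ?_
        have h3 : (q + 2) * A.D = (q + 1) * A.D + A.D := by ring
        omega
      refine ⟨(h5.trans (h8.mono (List.Subset.refl _) (fs' := [12, 8]) (by decide) le_rfl)).mono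
        (by decide) (by decide) le_rfl, fun i hi j => ?_, fun m hm => ?_⟩
      · rcases Nat.lt_or_eq_of_le hi with hi | rfl
        · rw [h10 _ (Or.inl ?_), h3 i (by omega)]
          have h10 : i * A.D ≤ q * A.D := Nat.mul_le_mul_right _ (by omega)
          have h11 : (q + 1) * A.D = q * A.D + A.D := by ring
          have := j.isLt
          omega
        · rw [h9, h6, h4 _ (by omega), zero_add, horner, Pi.add_apply, Finset.sum_eq_single (j : ℕ),
            if_pos rfl, h5.fld 5 (by decide), hs.fld 5 (by decide), ha, h5.fld 11 (by decide),
            hs.fld 11 (by decide), hx]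
          · rfl
          · intro p _ hp
            exact if_neg fun he => hp (by omega)
          · intro hj
            exact absurd (Finset.mem_range.2 j.isLt) hj
      · rw [h10 _ (Or.inr hm), h4]
        exact le_trans (Nat.mul_le_mul_right _ (by omega)) hm)
  exact ⟨h1, h2.1⟩

/-- One accumulation of `solveProg`. -/
theorem run_macLoop_solve (h : Loaded A l w s) {q : ℕ} (hq : q < w.length) (hc : s.nat 10 0 = q)
    {a c : ℕ} (ha : a ≠ 8) (ha2 : a ≠ 2) (hc8 : c ≠ 8) (hac : a ≠ c) {e : NExpr} (E : ℕ → ℕ)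
    (he : ∀ p < A.D, e.eval (update s.nat 11 0 p) = E p) {y : Fin A.D → Fin A.D → K}
    (hy : ∀ j k : Fin A.D, s.fld c (E j * A.D + k) = y j k) :
    Changes [11] [a, 8] (2 * A.D) s ((macLoop 11 dimE a (posE (.get 3 (.head 10)) (.head 11))
        2 (.head 10) c (posE e (.get 4 (.head 10)))).run s) ∧
      ∀ (i : Fin n) (j : Fin A.D), ((macLoop 11 dimE a (posE (.get 3 (.head 10)) (.head 11))
        2 (.head 10) c (posE e (.get 4 (.head 10)))).run s).fld a (i * A.D + j) =
          s.fld a (i * A.D + j) +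
            if w[q].1 = i then A.v w[q].1 w[q].2 * y j w[q].2 else 0 := by
  obtain ⟨h1, h2⟩ := run_macLoop (s := s) (t := 11) (x := dimE) (a := a)
    (i := posE (.get 3 (.head 10)) (.head 11)) (b := 2) (j := .head 10) (c := c)
    (k := posE e (.get 4 (.head 10))) (N := A.D) (fun p => w[q].1 * A.D + p) (fun _ => q)
    (fun p => E p * A.D + w[q].2) h.dim
    (fun p _ => by simp [posE, dimE, NExpr.eval, NExpr.head, update, hc, h.dim, h.var hq])
    (fun p _ => by simp [NExpr.eval, NExpr.head, update, hc])
    (fun p hp => by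
      simp [posE, he p hp, dimE, NExpr.eval, NExpr.head, update, hc, h.dim, h.coord hq])
    ha (by decide) hc8 (fun h => absurd h ha2) (fun h => absurd h hac)
  refine ⟨h1, fun i j => ?_⟩
  rw [h2]
  congr 1
  by_cases hi : w[q].1 = i
  · rw [if_pos hi, Finset.sum_eq_single (j : ℕ), if_pos (by rw [hi]), h.coord_entry hq, hy]
    · intro p _ hp
      exact if_neg fun he => hp (by rw [hi] at he; omega)
    · intro hj
      exact absurd (Finset.mem_range.2 j.isLt) hj
  · rw [if_neg hi]
    refine Finset.sum_eq_zero fun p hp => if_neg fun he => hi ?_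
    exact Fin.ext (mul_add_inj (Finset.mem_range.1 hp) j.isLt he).1

/-- One scan of the common list of entries of all `v_i` accumulates every inner product at once; for
a fixed `i` only its own entries contribute. -/
theorem sum_range_coords (hw : A.IsSparseV w) {i : Fin n} (hi : i ≠ 0) (y : Fin A.D → K) :
    (∑ p ∈ Finset.range w.length, if h : p < w.length then
      (if w[p].1 = i then A.v w[p].1 w[p].2 * y w[p].2 else 0) else 0) = y ⬝ᵥ A.v i := by
  rw [sum_range_length hw.1 (G := fun p => if p.1 = i then A.v p.1 p.2 * y p.2 else 0)
    (fun p hp => dif_pos hp), Fintype.sum_prod_type, Finset.sum_eq_single i]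
  · simp [dotProduct, mul_comm]
  · intro k _ hk
    simp [hk]
  · simp
  · intro p hp
    split_ifs with h
    · have : A.v p.1 p.2 = 0 := by
        by_contra hne
        exact hp ((hw.2 p).2 ⟨h ▸ hi, hne⟩)
      rw [this, zero_mul]
    · rfl

theorem run_solveProg (hw : A.IsSparseV w) (h : Loaded A l w s) {Z : ℕ → Fin A.D → K}
    (hk : ∀ i ≤ 2 * A.D, ∀ j : Fin A.D, s.fld 3 (i * A.D + j) = A.krylov i j)
    (hZ : ∀ t ≤ A.D, ∀ j : Fin A.D, s.fld 12 (t * A.D + j) = Z t j)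
    (h6 : s.fld 6 = 0) (h7 : s.fld 7 = 0) :
    Changes [10, 11] [6, 7, 8] (w.length * (4 * A.D)) s (solveProg.run s) ∧
      ∀ i : Fin n, i ≠ 0 → ∀ j : Fin A.D,
        (solveProg.run s).fld 6 (i * A.D + j) = A.krylov j ⬝ᵥ A.v i ∧
        (solveProg.run s).fld 7 (i * A.D + j) = Z (A.D - j) ⬝ᵥ A.v i := by
  obtain ⟨h1, h2⟩ := run_loop (cs := [10, 11]) (fs := [6, 7, 8]) (k := 4 * A.D)
    (t := 10) (N := w.length) (x := .get 0 (.const 3)) (s := s)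
    (c := .seq (macLoop 11 dimE 6 (posE (.get 3 (.head 10)) (.head 11))
        2 (.head 10) 3 (posE (.head 11) (.get 4 (.head 10))))
      (macLoop 11 dimE 7 (posE (.get 3 (.head 10)) (.head 11))
        2 (.head 10) 12 (posE (.sub dimE (.head 11)) (.get 4 (.head 10)))))
    (fun q s' => ∀ (i : Fin n) (j : Fin A.D),
      (s'.fld 6 (i * A.D + j) = ∑ p ∈ Finset.range q, if h : p < w.length then
        (if w[p].1 = i then A.v w[p].1 w[p].2 * A.krylov j w[p].2 else 0) else 0) ∧
      (s'.fld 7 (i * A.D + j) = ∑ p ∈ Finset.range q, if h : p < w.length then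
        (if w[p].1 = i then A.v w[p].1 w[p].2 * Z (A.D - j) w[p].2 else 0) else 0))
    h.length_w (by decide) (fun i j => ⟨by rw [h6]; rfl, by rw [h7]; rfl⟩) (fun q s' h => h)
    (fun q hq s' hs hc h3 => by
      have L' := h.of_changes hs (by decide) (by decide)
      obtain ⟨h4, h5⟩ := run_macLoop_solve (s := s') L' hq hc (a := 6) (c := 3) (by decide)
        (by decide) (by decide) (by decide) (e := .head 11) (fun p => p)
        (fun p _ => by simp [NExpr.eval, NExpr.head, update])
        (y := fun j k => A.krylov j k)
        (fun j k => by rw [hs.fld 3 (by decide), hk j (by have := j.isLt; omega)])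
      rw [Prog.run]
      set s1 := (macLoop 11 dimE 6 (posE (.get 3 (.head 10)) (.head 11))
        2 (.head 10) 3 (posE (.head 11) (.get 4 (.head 10)))).run s'
      have L1 := L'.of_changes h4 (by decide) (by decide)
      have hc1 : s1.nat 10 0 = q := by rw [h4.nat 10 (by decide), hc]
      obtain ⟨h8, h9⟩ := run_macLoop_solve (s := s1) L1 hq hc1 (a := 7) (c := 12) (by decide)
        (by decide) (by decide) (by decide) (e := .sub dimE (.head 11)) (fun p => A.D - p)
        (fun p _ => by simp [dimE, NExpr.eval, NExpr.head, update, L1.dim])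
        (y := fun j k => Z (A.D - j) k)
        (fun j k => by
          rw [h4.fld 12 (by decide), hs.fld 12 (by decide), hZ _ (Nat.sub_le _ _)])
      refine ⟨((h4.mono (cs' := [10, 11]) (fs' := [6, 7, 8]) (by decide) (by decide) le_rfl).trans
        (h8.mono (by decide) (by decide) le_rfl)).mono (List.Subset.refl _) (List.Subset.refl _)
        (by omega), fun i j => ⟨?_, ?_⟩⟩
      · rw [h8.fld 6 (by decide), h5, (h3 i j).1, Finset.sum_range_succ, dif_pos hq]
      · rw [h9, h4.fld 7 (by decide), (h3 i j).2, Finset.sum_range_succ, dif_pos hq])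
  exact ⟨h1, fun i hi j => ⟨((h2 i j).1).trans (sum_range_coords hw hi _),
    ((h2 i j).2).trans (sum_range_coords hw hi _)⟩⟩

end Success
-- Counting nonzero entries; the rows of the inverse Krylov matrix
namespace Input

variable {K : Type u} [Field K] {n : ℕ} [NeZero n] {A : Input.{u, v} K n}
  {l : List (Fin A.D × Fin A.D)} {w : List (Fin n × Fin A.D)}

theorem length_eq_nnzT (hl : A.IsSparseT l) : l.length = A.nnzT := by
  classical
  rw [nnzT, ← List.toFinset_card_of_nodup hl.1, ← Set.ncard_coe_finset]
  congr 1
  ext p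
  simpa using hl.2 p

/-- A nonsingular matrix has no zero column, so every column holds a nonzero entry. -/
theorem D_le_nnzT (hl : A.IsSparseT l) (hT : IsUnit A.T.det) : A.D ≤ A.nnzT := by
  classical
  rw [← length_eq_nnzT hl, ← List.toFinset_card_of_nodup hl.1]
  have h : (Finset.univ : Finset (Fin A.D)) ⊆ l.toFinset.image Prod.snd := by
    intro j _
    by_contra hj
    refine hT.ne_zero (det_eq_zero_of_column_eq_zero j fun i => ?_)
    by_contra hne
    exact hj (Finset.mem_image.2 ⟨(i, j), by simpa using (hl.2 (i, j)).2 hne, rfl⟩)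
  simpa using (Finset.card_le_card h).trans Finset.card_image_le

/-- A standard variable is its own normal form, as a nonzero element of `I` cannot be supported on
standard monomials. -/
theorem ε_eq_single {i : Fin n} (hi : Finsupp.single i 1 ∈ standardMonomials A.ord A.I)
    {k : Fin A.D} (hk : A.v i k ≠ 0) : A.ε k = Finsupp.single i 1 := by
  classical
  have h : X i - A.toPoly (A.v i) = 0 := by
    refine A.eq_zero_of_mem_of_support (A.v_spec i).1 fun s hs => ?_
    rcases Finset.mem_union.1 (support_sub _ _ _ hs) with hs | hs
    · rw [support_X, Finset.mem_singleton] at hs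
      exact hs ▸ hi
    · exact A.mem_standardMonomials_of_mem_support _ hs
  rw [← A.coeff_toPoly (A.v i) k, ← sub_eq_zero.1 h, coeff_X] at hk
  by_contra hne
  exact hk (if_neg (Ne.symm hne))

/-- An entry belonging to a standard variable is determined by its position `k`, because `ε_k` is
that variable; so there are at most `D` of these, independently of `n`. -/
theorem length_le_nnzElim (hw : A.IsSparseV w) : w.length ≤ A.nnzElim + A.D := by
  classical
  rw [← List.toFinset_card_of_nodup hw.1, ← Finset.card_filter_add_card_filter_not
    (fun p : Fin n × Fin A.D => Finsupp.single p.1 1 ∉ standardMonomials A.ord A.I)]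
  refine Nat.add_le_add (le_of_eq ?_) ?_
  · rw [nnzElim, ← Set.ncard_coe_finset]
    congr 1
    ext p
    simp [hw.2 p]
    tauto
  · refine (Finset.card_le_card_of_injOn Prod.snd (fun _ _ => Finset.mem_univ _)
      ?_).trans_eq (Finset.card_fin _)
    rintro ⟨i, k⟩ hp ⟨i', k'⟩ hp' (rfl : k = k')
    simp only [Finset.coe_filter, List.mem_toFinset, not_not, Set.mem_ofPred_eq, hw.2] at hp hp'
    have h := (ε_eq_single hp.2 hp.1.2).symm.trans (ε_eq_single hp'.2 hp'.1.2)
    rw [Finsupp.single_left_inj one_ne_zero] at h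
    rw [h]

/-- The vector dual to `T ^ (D - 1) e` that the Berlekamp–Massey algorithm provides. -/
theorem dual_dotProduct {g h : Polynomial K} {b : K}
    (B : IsBerlekampMassey A.seq (2 * A.D) A.D g h b) {x : Fin A.D → K}
    (hx : ∀ j, x j = ∑ k ∈ Finset.range (2 * A.D + 1), h.coeff k * (1 / b) * A.krylov k j)
    (i : ℕ) (hi : i < A.D) : x ⬝ᵥ (A.T ^ i *ᵥ A.e) = if i + 1 = A.D then 1 else 0 := by
  have hx' : x = ∑ k ∈ Finset.range (2 * A.D + 1), (h.coeff k * (1 / b)) • A.krylov k := by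
    funext j
    simp [hx, Finset.sum_apply]
  have h1 := moment_eq_sum A.seq (p := h) (m := 2 * A.D + 1)
    (by have := B.natDegree_add_le; omega) i
  rw [B.moment_eq i hi] at h1
  have h2 : x ⬝ᵥ (A.T ^ i *ᵥ A.e) = (1 / b) * if i + 1 = A.D then b else 0 := by
    rw [h1, hx', sum_dotProduct, Finset.mul_sum]
    refine Finset.sum_congr rfl fun k _ => ?_
    rw [smul_dotProduct, krylov, transpose_pow_dotProduct, mulVec_mulVec, ← pow_add, add_comm k i,
      seq, smul_eq_mul]
    ring
  rw [h2, mul_ite, mul_zero, one_div, inv_mul_cancel₀ B.ne_zero]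

theorem horner_dotProduct_v {f : Polynomial K} (hf : IsMinPoly A.seq (2 * A.D) f)
    (hD : f.natDegree = A.D) {x : Fin A.D → K}
    (hx : ∀ i < A.D, x ⬝ᵥ (A.T ^ i *ᵥ A.e) = if i + 1 = A.D then 1 else 0) (i : Fin n)
    (k : Fin A.D) : horner A.T f.coeff x (A.D - k) ⬝ᵥ A.v i = A.sol i k := by
  rw [sol_eq (isUnit_det_hankel hf hD), inv_eq_left_inv
    (horner_mul_krylovMatrix A.T A.e x (aeval_eq_zero hf hD) hf.1.1 hD hx)]
  rfl

end Input

/-! ### The whole method -/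

section Main

variable {K : Type u} [Field K] [DecidableEq K] {n : ℕ} [NeZero n] {A : Input.{u, v} K n}
  {l : List (Fin A.D × Fin A.D)} {w : List (Fin n × Fin A.D)} {f : Polynomial K}

theorem run_wiedemannProg (hf : IsMinPoly A.seq (2 * A.D) f) (hl : A.IsSparseT l)
    (hw : A.IsSparseV w) :
    (f.natDegree ≠ A.D → (wiedemannProg.run (A.initState l w)).IsFail) ∧
      (f.natDegree = A.D → A.IsSuccess f (wiedemannProg.run (A.initState l w)) ∧
        (wiedemannProg.run (A.initState l w)).ops ≤ 2 * A.D * (2 * l.length) +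
          (2 * A.D * (8 * A.D + 7) + ((1 + 2 * (2 * A.D + 1) + (2 * A.D + 1) * (2 * A.D)) +
          (A.D * (2 * l.length + 2 * A.D) + w.length * (4 * A.D))))) := by
  have L0 : Loaded A l w (A.initState l w) := ⟨fun _ _ => rfl, fun _ _ => rfl⟩
  have z0 : ∀ a, 3 ≤ a → (A.initState l w).fld a = 0 := fun a ha => by
    match a, ha with
    | _ + 3, _ => rfl
  have n0 : ∀ a, 5 ≤ a → (A.initState l w).nat a = 0 := fun a ha => by
    match a, ha with
    | _ + 5, _ => rfl
  have o0 : (A.initState l w).ops = 0 := rfl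
  simp only [wiedemannProg, Prog.run.eq_2]
  generalize A.initState l w = s0 at *
  obtain ⟨h1, k1⟩ := run_krylovProg hl L0 (z0 3 (by decide))
  generalize krylovProg.run s0 = s1 at *
  have L1 := L0.of_changes h1 (by decide) (by decide)
  obtain ⟨h2, k2⟩ := run_seqProg L1 k1
  generalize seqProg.run s1 = s2 at *
  have c2 := (h1.mono (fs' := [3, 4, 8]) (List.Subset.refl _) (by decide) le_rfl).trans
    (h2.mono (cs' := [10, 11]) (by decide) (by decide) le_rfl)
  have L2 := L0.of_changes c2 (by decide) (by decide)
  obtain ⟨h3, L, g, h, b, R, B⟩ := run_berlekampMasseyProg (s := s2) L2.dim k2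
    (by rw [c2.nat 6 (by decide), n0 6 (by decide)]; rfl)
    (by rw [c2.fld 5 (by decide), z0 5 (by decide)])
    (by rw [c2.fld 9 (by decide), z0 9 (by decide)])
    (by rw [c2.fld 15 (by decide), z0 15 (by decide)])
  generalize berlekampMasseyProg.run s2 = s3 at *
  have c3 := (c2.mono (cs' := [6, 10, 11]) (fs' := [3, 4, 5, 8, 9, 10, 13]) (by decide)
    (by decide) le_rfl).trans (h3.mono (List.Subset.refl _) (by decide) le_rfl)
  have L3 := L0.of_changes c3 (by decide) (by decide)
  have hL : f.natDegree = L := le_antisymm (B.natDegree ▸ hf.2 g B.isCharPoly) (B.le_natDegree hf.1)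
  have hE : (NExpr.add (.sub (.head 6) dimE) (.sub dimE (.head 6))).eval s3.nat =
      L - A.D + (A.D - L) := by
    simp [NExpr.eval, NExpr.head, dimE, L3.dim, R.length]
  rw [Prog.run, hE, hL]
  refine ⟨fun hne => ?_, fun hD => ?_⟩
  · rw [if_neg (by omega), Prog.run, State.IsFail, c3.nat 5 (by decide), n0 5 (by decide)]
    rfl
  subst hD
  -- Minimal polynomials of a finite sequence need not be unique, but in degree `D` both the
  -- computed and the given one equal the characteristic polynomial of `T`.
  have hgf : g = f := (eq_charpoly hf hL B.isCharPoly B.natDegree).trans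
    (eq_charpoly hf hL hf.1 hL).symm
  subst hgf
  rw [if_pos (by omega)]
  simp only [Prog.run.eq_2]
  have k3 : ∀ i ≤ 2 * A.D, ∀ j : Fin A.D, s3.fld 3 (i * A.D + j) = A.krylov i j := fun i hi j => by
    rw [h3.fld 3 (by decide), h2.fld 3 (by decide), k1 i hi j]
  obtain ⟨h4, k4⟩ := run_dualProg L3 (g := h) (b := b) (by have := B.natDegree_add_le; omega) k3
    R.aux R.disc (by rw [c3.fld 11 (by decide), z0 11 (by decide)])
    (by rw [c3.fld 14 (by decide), z0 14 (by decide)])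
  generalize dualProg.run s3 = s4 at *
  have L4 := L3.of_changes h4 (by decide) (by decide)
  obtain ⟨h5, k5⟩ := run_hornerProg hl L4 (a := g.coeff) (x := fun j => s4.fld 11 j)
    (fun k => by rw [h4.fld 5 (by decide), R.poly]) (fun j => rfl)
    (by rw [h4.fld 12 (by decide), c3.fld 12 (by decide), z0 12 (by decide)])
  generalize hornerProg.run s4 = s5 at *
  have c5 := (h4.mono (cs' := [10, 11]) (fs' := [8, 10, 11, 12, 14]) (by decide) (by decide)
    le_rfl).trans (h5.mono (List.Subset.refl _) (by decide) le_rfl)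
  have L5 := L3.of_changes c5 (by decide) (by decide)
  obtain ⟨h6, k6⟩ := run_solveProg hw L5
    (fun i hi j => by rw [c5.fld 3 (by decide), k3 i hi j]) k5
    (by rw [c5.fld 6 (by decide), c3.fld 6 (by decide), z0 6 (by decide)])
    (by rw [c5.fld 7 (by decide), c3.fld 7 (by decide), z0 7 (by decide)])
  generalize solveProg.run s5 = s6 at *
  have h7 := changes_setN 5 (.const 0) (.const 1) s6
  have k7 : ((Prog.setN 5 (.const 0) (.const 1)).run s6).nat 5 0 = 1 := run_setN_nat _ _ _ _
  generalize (Prog.setN 5 (.const 0) (.const 1)).run s6 = s7 at *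
  have c7 := (c5.mono (cs' := [5, 10, 11]) (fs' := [6, 7, 8, 10, 11, 12, 14]) (by decide)
    (by decide) le_rfl).trans ((h6.mono (cs' := [5, 10, 11])
    (fs' := [6, 7, 8, 10, 11, 12, 14]) (by decide) (by decide) le_rfl).trans
    (h7.mono (by decide) (by decide) le_rfl))
  refine ⟨{
    flag := k7
    krylov := fun i hi j => by rw [c7.fld 3 (by decide), k3 i hi.le j]
    seq := fun i hi => by rw [c7.fld 4 (by decide), R.seq i hi]
    minPoly := fun k _ => by rw [c7.fld 5 (by decide), R.poly]
    rhs := fun i hi j => by rw [h7.fld 6 (by decide), (k6 i hi j).1]; rfl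
    sol := fun i hi k => by
      rw [h7.fld 7 (by decide), (k6 i hi k).2,
        Input.horner_dotProduct_v hf hL (Input.dual_dotProduct B k4)] }, ?_⟩
  have := c3.ops
  have := c7.ops
  omega

end Main
end ShapeLex

theorem theorem3p2 :
    ∃ (P : ShapeLex.Prog) (C : ℝ), 0 < C ∧
      ∀ (K : Type u) [Field K] [DecidableEq K] (n : ℕ) [NeZero n]
        (A : ShapeLex.Input.{u, v} K n) (f : Polynomial K),
        ShapeLex.IsMinPoly A.seq (2 * A.D) f →
        -- correctness of the method
        (f.natDegree = A.D →
          Module.finrank K (MvPolynomial (Fin n) K ⧸ A.I) = A.D ∧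
          ShapeLex.IsShapePosition A.I ∧
          IsUnit (ShapeLex.hankel A.D A.seq).det ∧
          ShapeLex.IsReducedGroebnerBasis (ShapeLex.lexOrder n) A.I
            (Set.range (ShapeLex.shapeFamily f A.solPoly))) ∧
        -- the program carries the method out, within the stated number of field operations
        ∀ (l : List (Fin A.D × Fin A.D)) (w : List (Fin n × Fin A.D)),
          A.IsSparseT l → A.IsSparseV w →
          (f.natDegree ≠ A.D → (P.run (A.initState l w)).IsFail) ∧
          (f.natDegree = A.D →
            A.IsSuccess f (P.run (A.initState l w)) ∧
            (IsUnit A.T.det →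
              ((P.run (A.initState l w)).ops : ℝ) ≤
                C * (A.D * (A.nnzT + n * Real.log A.D + A.nnzElim)))) := by

  -- The operation bound is `6 D N_1 + 22 D² + 20 D + 3 + 4 D W`, where `W` is the length of `w`.
  -- With `1 ≤ D ≤ N_1` and `W ≤ E + D` the coefficients of `D N_1` add up to `6 + 22 + 20 + 3 + 4 =
  -- 55`.
  refine ⟨ShapeLex.wiedemannProg, 55, by norm_num, fun K _ _ n _ A f hf => ⟨fun hD => ?_,
    fun l w hl hw => ?_⟩⟩
  · exact ⟨A.finrank_quotient, ⟨f, A.solPoly, ShapeLex.Input.isReducedGroebnerBasis hf hD⟩,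
      ShapeLex.isUnit_det_hankel hf hD, ShapeLex.Input.isReducedGroebnerBasis hf hD⟩
  · obtain ⟨h1, h2⟩ := ShapeLex.run_wiedemannProg hf hl hw
    refine ⟨h1, fun hD => ⟨(h2 hD).1, fun hT => ?_⟩⟩
    have h3 := (h2 hD).2
    have h4 := ShapeLex.Input.D_le_nnzT hl hT
    have h5 := ShapeLex.Input.length_le_nnzElim hw
    have h6 := A.D_pos
    rw [ShapeLex.Input.length_eq_nnzT hl] at h3
    have h7 : (ShapeLex.wiedemannProg.run (A.initState l w)).ops ≤
        55 * (A.D * (A.nnzT + A.nnzElim)) := by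
      have a1 : A.D * A.D ≤ A.D * A.nnzT := Nat.mul_le_mul_left _ h4
      have a2 : w.length * A.D ≤ (A.nnzElim + A.D) * A.D := Nat.mul_le_mul_right _ h5
      have a3 : A.D * 1 ≤ A.D * A.D := Nat.mul_le_mul_left _ h6
      nlinarith
    have h8 : (0 : ℝ) ≤ n * Real.log A.D :=
      mul_nonneg (Nat.cast_nonneg n) (Real.log_natCast_nonneg A.D)
    calc ((ShapeLex.wiedemannProg.run (A.initState l w)).ops : ℝ)
        ≤ 55 * (A.D * (A.nnzT + A.nnzElim)) := by exact_mod_cast h7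
      _ ≤ 55 * (A.D * (A.nnzT + n * Real.log A.D + A.nnzElim)) := by
        gcongr
        linarith
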